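/- For every real $\alpha>0$ and every integer $k\ge 0$ there exist constants $C,c>0$ such that the following holds for all sufficiently large integers $n$. Let $G_\alpha$ be a graph on $n$ vertices with minimum degree $\delta(G_\alpha)\ge \alpha n$, let $b$ be an integer with $1\le b\le cn$, and let $p\in[0,1]$ satisfy $p\ge \frac{Cb}{n^2}$. Let $G_{n,p}$ be the binomial random graph on the vertex set of $G_\alpha$, in which each pair of vertices forms an edge independently with probability $p$. Then with probability at least $1-\exp(-cpn^2)$ the following holds: playing a $(1:b)$ Waiter-Client game on the edges of $G_\alpha\cup G_{n,p}$, Waiter has a strategy to force Client to claim a spanning $k$-vertex-connected subgraph of $G_\alpha\cup G_{n,p}$. Here, in every round of the $(1:b)$ Waiter-Client game on a finite set $X$ (with $b\ge 1$), Waiter offers Client $b+1$ elements of $X$ which have not been offered before; Client claims one of them and all the others go to Waiter. If at least two but at most $b$ elements are left, then in a last round Waiter offers all of them, Client claims one and the others go to Waiter; if a single element is left, it goes to Waiter. A graph is $k$-vertex-connected if it has more than $k$ vertices and remains connected after the deletion of any fewer than $k$ vertices. -/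

import Mathlib

/-- A graph `G` is `k`-vertex-connected: it has more than `k` vertices, and deleting any set of
fewer than `k` vertices leaves a connected graph. -/
def SimpleGraph.IsVertexConnected {V : Type*} [Fintype V] (k : ℕ) (G : SimpleGraph V) : Prop :=
  k < Fintype.card V ∧
    ∀ S : Finset V, S.card < k → (G.induce {v : V | v ∉ S}).Connected

namespace WaiterClient

/-- Legal offers of Waiter in the `(1 : b)` Waiter-Client game when `free` is the set of elements
that have not been chosen before. She offers exactly `b + 1` free elements; only in the last round,
when at most `b` but at least two free elements are left, she offers all of these. A single
remaining element (when `b ≥ 1`) is not offered: it is not claimed by Client. -/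
def IsLegalOffer {X : Type*} (b : ℕ) (free offer : Finset X) : Prop :=
  offer ⊆ free ∧ (offer.card = b + 1 ∨ (offer = free ∧ 2 ≤ free.card ∧ free.card ≤ b))

/-- `WaiterWinsFrom b 𝓕 free client`: in the `(1 : b)` Waiter-Client game with family of winning
sets `𝓕`, Waiter has a winning strategy from the position in which `free` is the set of elements not
chosen so far and `client` is the set of elements claimed by Client. Either Client has already
fully claimed a winning set, or Waiter has a legal offer such that, whichever offered element `e`
Client claims (all the other offered elements going to Waiter), Waiter has a winning strategy
from the resulting position. -/
inductive WaiterWinsFrom {X : Type*} [DecidableEq X] (b : ℕ) (𝓕 : Set (Finset X)) :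
    Finset X → Finset X → Prop
  | claimed {free client A : Finset X} (hA : A ∈ 𝓕) (hsub : A ⊆ client) :
      WaiterWinsFrom b 𝓕 free client
  | round {free client offer : Finset X} (hoffer : IsLegalOffer b free offer)
      (h : ∀ e ∈ offer, WaiterWinsFrom b 𝓕 (free \ offer) (insert e client)) :
      WaiterWinsFrom b 𝓕 free client

/-- Waiter has a winning strategy in the `(1 : b)` Waiter-Client game on the hypergraph
`(board, 𝓕)`. -/
def WaiterWins {X : Type*} [DecidableEq X] (b : ℕ) (board : Finset X) (𝓕 : Set (Finset X)) : Prop :=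
  WaiterWinsFrom b 𝓕 board ∅

end WaiterClient

/-- The edge sets of all spanning `k`-vertex-connected subgraphs of `G`. -/
def SimpleGraph.vertexConnectedFamily {V : Type*} [Fintype V] (k : ℕ) (G : SimpleGraph V) :
    Set (Finset (Sym2 V)) :=
  {A | ∃ H : SimpleGraph V, H ≤ G ∧ H.IsVertexConnected k ∧ (A : Set (Sym2 V)) = H.edgeSet}

open scoped Classical in
/-- Playing the `(1 : b)` Waiter-Client game on the edges of `G`, Waiter has a strategy to force
Client to claim a spanning `k`-vertex-connected subgraph of `G`. -/
def SimpleGraph.WaiterForcesVertexConnected {V : Type*} [Fintype V] (k b : ℕ)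
    (G : SimpleGraph V) : Prop :=
  WaiterClient.WaiterWins b G.edgeFinset (G.vertexConnectedFamily k)

/-! The vertices split, using only `G`, into boundedly many parts, each inducing a subgraph of
linear minimum degree without sparse cuts (`exists_partition_without_sparse_cuts`). The partition
maximises the number of ordered monochromatic adjacent pairs plus a bonus for every colour used:
merging, moving one vertex and splitting are the only competitors needed.

Waiter then plays in three phases. In the first she offers only edges of `G` inside parts and makes
Client hit every dense edge set between disjoint subsets of one part. There are at most `4 ^ n` such
sets, and by averaging `b + 1` available edges can be found that each lie in a constant proportion
of the sets not yet hit, so linearly many rounds suffice (`canReach_transversal`). Edges at vertices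
where many edges were already offered are avoided. Client's graph then contains, in every part, a
core covering all but a few vertices that stays connected after deletion of fewer than `k` vertices
(`IsDensePart.exists_highlyConnected_core`).

In the second phase every vertex outside the cores still has many free edges into the core of its
part, and Client is made to take `k` of them. In the third, Client takes `k` disjoint edges from
each part to one fixed part. These come from `k` disjoint blocks of linear size chosen in each part,
and `b + 1` edges between matching blocks are enough. `isVertexConnected_of_cores` assembles the
result.

The random graph is needed only for the third phase. The blocks depend on `G` alone and are
boundedly many, so a Chernoff bound and a union bound suffice
(`one_sub_le_binomialRandom_real_links`). The first phase is what limits `b` to linear size: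
linearly many rounds of `b + 1` edges must stay within a small multiple of `n ^ 2`. -/

namespace WaiterClient

/-! ### Composing phases of play and forcing inside disjoint boxes -/

/-- `CanReach b Q free client`: from the position `(free, client)` Waiter can, making only offers of
exactly `b + 1` free elements, force a position that satisfies `Q`. -/
inductive CanReach {X : Type*} [DecidableEq X] (b : ℕ) (Q : Finset X → Finset X → Prop) :
    Finset X → Finset X → Prop
  | done {free client : Finset X} (h : Q free client) : CanReach b Q free client
  | round {free client offer : Finset X} (hsub : offer ⊆ free) (hcard : offer.card = b + 1)
      (h : ∀ e ∈ offer, CanReach b Q (free \ offer) (insert e client)) :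
      CanReach b Q free client

variable {X : Type*} [DecidableEq X] {b : ℕ} {Q Q' : Finset X → Finset X → Prop}
  {free client : Finset X}

/-- Phases of play are chained with this. The monotonicity facts handed to the next phase keep
Client's earlier gains and ensure that he owns only elements of the original position. -/
theorem CanReach.bind (h : CanReach b Q free client)
    (hQ : ∀ free' client', free' ⊆ free → client ⊆ client' → client' ⊆ client ∪ free →
      Q free' client' → CanReach b Q' free' client') : CanReach b Q' free client := by
  induction h with
  | done h => exact hQ _ _ subset_rfl subset_rfl Finset.subset_union_left h
  | @round free client offer hsub hcard h ih =>
    refine .round hsub hcard fun e he => ih e he fun free' client' h1 h2 h3 h4 => ?_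
    refine hQ _ _ (h1.trans Finset.sdiff_subset) ((Finset.subset_insert _ _).trans h2) ?_ h4
    refine h3.trans (Finset.union_subset ?_ ?_)
    · exact Finset.insert_subset (Finset.mem_union_right _ (hsub he)) Finset.subset_union_left
    · exact Finset.sdiff_subset.trans Finset.subset_union_right

theorem CanReach.mono (h : CanReach b Q free client)
    (hQ : ∀ free' client', free' ⊆ free → client ⊆ client' → client' ⊆ client ∪ free →
      Q free' client' → Q' free' client') : CanReach b Q' free client :=
  h.bind fun f c h1 h2 h3 h4 => .done (hQ f c h1 h2 h3 h4)

/-- Since the whole strategy uses full offers only, the special rule for a short last round never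
has to be considered. -/
theorem CanReach.waiterWinsFrom {𝓕 : Set (Finset X)}
    (h : CanReach b (fun _ client' => ∃ A ∈ 𝓕, A ⊆ client') free client) :
    WaiterWinsFrom b 𝓕 free client := by
  induction h with
  | done h => obtain ⟨A, hA, hs⟩ := h; exact .claimed hA hs
  | round hsub hcard _ ih => exact .round ⟨hsub, .inl hcard⟩ ih

/-- Waiter can force Client to claim `k` elements of a set of at least `k * (b + 1)` free
elements, offering only elements of this set. -/
theorem canReach_subset_card (k : ℕ) (E : Finset X) (hE : E ⊆ free) (hcard : k * (b + 1) ≤ E.card) :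
    CanReach b (fun free' client' => free \ E ⊆ free' ∧ ∃ K ⊆ E, K.card = k ∧ K ⊆ client')
      free client := by
  induction k generalizing E free client with
  | zero => exact .done ⟨Finset.sdiff_subset, ∅, by simp⟩
  | succ k ih =>
    obtain ⟨offer, ho, hoc⟩ := Finset.exists_subset_card_eq
      (show b + 1 ≤ E.card by nlinarith [Nat.zero_le (k * (b + 1))])
    refine .round (ho.trans hE) hoc fun e he => ?_
    have hc : k * (b + 1) ≤ (E \ offer).card := by
      rw [Finset.card_sdiff_of_subset ho, hoc]
      apply Nat.le_sub_of_add_le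
      linarith
    refine (ih (E \ offer) (Finset.sdiff_subset_sdiff hE subset_rfl) hc).mono ?_
    rintro free' client' h1 h2 h3 ⟨h4, K, hK, hKc, hKs⟩
    refine ⟨?_, insert e K, ?_, ?_, ?_⟩
    · refine subset_trans ?_ h4
      intro x hx
      simp only [Finset.mem_sdiff] at hx ⊢
      exact ⟨⟨hx.1, fun h => hx.2 (ho h)⟩, fun h => hx.2 h.1⟩
    · exact Finset.insert_subset (ho he) (hK.trans Finset.sdiff_subset)
    · rw [Finset.card_insert_of_notMem, hKc]
      exact fun h => (Finset.mem_sdiff.1 (hK h)).2 he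
    · exact Finset.insert_subset (h2 (Finset.mem_insert_self _ _)) hKs

/-- Waiter can force Client to claim `k` elements of each set of a disjoint family of sets of at
least `k * (b + 1)` free elements, offering only elements of these sets. -/
theorem canReach_disjoint_family {ι : Type*} [DecidableEq ι] (k : ℕ) (I : Finset ι)
    (E : ι → Finset X)
    (hdisj : (I : Set ι).PairwiseDisjoint E) (hE : ∀ i ∈ I, E i ⊆ free)
    (hcard : ∀ i ∈ I, k * (b + 1) ≤ (E i).card) :
    CanReach b (fun free' client' => free \ I.biUnion E ⊆ free' ∧
      ∀ i ∈ I, ∃ K ⊆ E i, K.card = k ∧ K ⊆ client') free client := by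
  induction I using Finset.induction_on generalizing free client with
  | empty => exact .done ⟨Finset.sdiff_subset, by simp⟩
  | insert i I hi ih =>
    refine (canReach_subset_card k (E i) (hE i (by simp)) (hcard i (by simp))).bind ?_
    rintro free₁ client₁ h1 h2 h3 ⟨h4, K, hK, hKc, hKs⟩
    refine (ih (hdisj.subset (by simp)) (fun j hj => ?_) fun j hj => hcard j (by simp [hj])).mono ?_
    · refine subset_trans (fun x hx => Finset.mem_sdiff.2 ⟨hE j (by simp [hj]) hx, fun h => ?_⟩) h4
      have : Disjoint (E i) (E j) := hdisj (by simp) (by simp [hj]) (by rintro rfl; exact hi hj)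
      exact Finset.disjoint_left.1 this h hx
    · rintro free₂ client₂ g1 g2 g3 ⟨g4, g5⟩
      refine ⟨?_, ?_⟩
      · refine subset_trans ?_ g4
        intro x hx
        rw [Finset.biUnion_insert, Finset.mem_sdiff, Finset.mem_union, not_or] at hx
        exact Finset.mem_sdiff.2 ⟨h4 (Finset.mem_sdiff.2 ⟨hx.1, hx.2.1⟩), hx.2.2⟩
      · intro j hj
        rcases Finset.mem_insert.1 hj with rfl | hj
        · exact ⟨K, hK, hKc, hKs.trans g2⟩
        · exact g5 j hj

end WaiterClient

/-! ### Hitting all members of a family of dense edge sets -/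

namespace WaiterClient

/-- If every member of a nonempty family of subsets of `B` has more than `b + β * #B` elements in
`A`, then `b + 1` elements of `A` belong to at least a proportion `β` of the family each. -/
theorem exists_popular_subset {X : Type*} [DecidableEq X] {b : ℕ} {β : ℝ} (hβ : 0 ≤ β)
    {A B : Finset X} {𝓢 : Finset (Finset X)} (hne : 𝓢.Nonempty) (hB : ∀ F ∈ 𝓢, F ⊆ B)
    (hA : ∀ F ∈ 𝓢, b + β * B.card < (F ∩ A).card) :
    ∃ offer ⊆ A ∩ B, offer.card = b + 1 ∧
      ∀ e ∈ offer, β * 𝓢.card ≤ (𝓢.filter (e ∈ ·)).card := by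
  set P : Finset X := (A ∩ B).filter fun e => β * 𝓢.card ≤ (𝓢.filter (e ∈ ·)).card with hP
  suffices h : b + 1 ≤ P.card by
    obtain ⟨offer, ho, hoc⟩ := Finset.exists_subset_card_eq h
    exact ⟨offer, ho.trans (Finset.filter_subset _ _), hoc,
      fun e he => (Finset.mem_filter.1 (ho he)).2⟩
  by_contra! hlt
  have hpos : (0 : ℝ) < 𝓢.card := by exact_mod_cast hne.card_pos
  -- Double counting of incidences. If at most `b` elements were popular, they would contribute at
  -- most `b` per member on average, and the unpopular ones less than the rest of the assumed lower
  -- bound allows.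
  have hcount : ∑ F ∈ 𝓢, ((F ∩ A).card : ℝ) = ∑ e ∈ A ∩ B, ((𝓢.filter (e ∈ ·)).card : ℝ) := by
    have := Finset.sum_card_bipartiteAbove_eq_sum_card_bipartiteBelow
      (s := 𝓢) (t := A ∩ B) (fun F e => e ∈ F)
    have h2 : ∀ F ∈ 𝓢, (Finset.bipartiteAbove (fun F e => e ∈ F) (A ∩ B) F) = F ∩ A := by
      intro F hF
      ext e
      simp only [Finset.mem_bipartiteAbove, Finset.mem_inter]
      exact ⟨fun h => ⟨h.2, h.1.1⟩, fun h => ⟨⟨h.2, hB F hF h.1⟩, h.1⟩⟩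
    rw [Finset.sum_congr rfl fun F hF => by rw [h2 F hF]] at this
    exact_mod_cast this
  have hlow : 𝓢.card * (b + β * B.card) < ∑ F ∈ 𝓢, ((F ∩ A).card : ℝ) := by
    rw [← nsmul_eq_mul, ← Finset.sum_const]
    exact Finset.sum_lt_sum_of_nonempty hne hA
  have hup : ∑ e ∈ A ∩ B, ((𝓢.filter (e ∈ ·)).card : ℝ) ≤ 𝓢.card * (b + β * B.card) := by
    rw [← Finset.sum_filter_add_sum_filter_not (A ∩ B)
      fun e => β * 𝓢.card ≤ (𝓢.filter (e ∈ ·)).card]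
    have h1 : ∑ e ∈ P, ((𝓢.filter (e ∈ ·)).card : ℝ) ≤ 𝓢.card * b := by
      calc _ ≤ ∑ e ∈ P, (𝓢.card : ℝ) :=
            Finset.sum_le_sum fun e _ => by exact_mod_cast Finset.card_filter_le _ _
        _ = P.card * 𝓢.card := by rw [Finset.sum_const, nsmul_eq_mul]
        _ ≤ 𝓢.card * b := by
            rw [mul_comm]
            have : (P.card : ℝ) ≤ b := by exact_mod_cast Nat.lt_succ_iff.1 hlt
            gcongr
    have h2 : ∑ e ∈ (A ∩ B).filter (fun e => ¬ β * 𝓢.card ≤ (𝓢.filter (e ∈ ·)).card),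
        ((𝓢.filter (e ∈ ·)).card : ℝ) ≤ 𝓢.card * (β * B.card) := by
      calc _ ≤ ∑ e ∈ (A ∩ B).filter (fun e => ¬ β * 𝓢.card ≤ (𝓢.filter (e ∈ ·)).card),
              β * 𝓢.card :=
            Finset.sum_le_sum fun e he => (not_le.1 (Finset.mem_filter.1 he).2).le
        _ ≤ ∑ e ∈ B, β * 𝓢.card :=
            Finset.sum_le_sum_of_subset_of_nonneg
              ((Finset.filter_subset _ _).trans Finset.inter_subset_right)
              fun _ _ _ => by positivity
        _ = 𝓢.card * (β * B.card) := by rw [Finset.sum_const, nsmul_eq_mul]; ring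
    rw [mul_add]
    exact add_le_add h1 h2
  linarith

variable {V : Type*} [DecidableEq V]

/-- Every edge is counted at no more than two vertices. This bounds the number of vertices at which
many edges have been offered. -/
theorem card_mul_le_of_le_card_incident (Y : Finset (Sym2 V)) (Z : Finset V) {x : ℝ}
    (hZ : ∀ z ∈ Z, x ≤ (Y.filter (z ∈ ·)).card) : Z.card * x ≤ 2 * Y.card := by
  have h := Finset.sum_card_bipartiteAbove_eq_sum_card_bipartiteBelow
      (s := Z) (t := Y) (fun z e => z ∈ e)
  have h1 : Z.card * x ≤ ∑ z ∈ Z, ((Y.filter (z ∈ ·)).card : ℝ) := by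
    rw [← nsmul_eq_mul, ← Finset.sum_const]
    exact Finset.sum_le_sum hZ
  have h2 : ∑ e ∈ Y, (Finset.bipartiteBelow (fun z e => z ∈ e) Z e).card ≤ ∑ e ∈ Y, 2 := by
    refine Finset.sum_le_sum fun e _ => ?_
    induction e with | _ u w =>
    calc _ ≤ ({u, w} : Finset V).card := Finset.card_le_card fun z hz => by
          simpa using (Finset.mem_filter.1 hz).2
      _ ≤ 2 := Finset.card_le_two
  rw [← h, Finset.sum_const, smul_eq_mul] at h2
  refine h1.trans ?_
  rw [mul_comm (2 : ℝ)]
  exact_mod_cast h2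

variable [Fintype V]

theorem card_filter_incident_le (F : Finset (Sym2 V)) (Z : Finset V) :
    (F.filter fun e => ∃ z ∈ Z, z ∈ e).card ≤ Z.card * Fintype.card V := by
  calc _ ≤ ((Z ×ˢ (Finset.univ : Finset V)).image fun p => s(p.1, p.2)).card := by
        refine Finset.card_le_card fun e he => ?_
        obtain ⟨-, z, hz, hze⟩ := Finset.mem_filter.1 he
        obtain ⟨w, rfl⟩ := Sym2.mem_iff_exists.1 hze
        exact Finset.mem_image.2 ⟨(z, w), by simp [hz], rfl⟩
    _ ≤ _ := by
        refine Finset.card_image_le.trans ?_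
        rw [Finset.card_product, Finset.card_univ]

/-- A member of the family keeps many elements that are free and do not meet vertices at which many
edges were offered. -/
theorem card_inter_allowed_ge {ε ξ τ : ℝ} (hξ : 0 < ξ) (hτε : τ + 2 * τ / ξ ≤ ε / 2)
    {E F free : Finset (Sym2 V)} (hFE : F ⊆ E) (hF : ε * Fintype.card V ^ 2 ≤ F.card)
    (hused : ((E \ free).card : ℝ) ≤ τ * Fintype.card V ^ 2) (hV : 0 < Fintype.card V) :
    ε / 2 * Fintype.card V ^ 2 ≤ (F ∩ free.filter (fun e => ∀ v ∈ e,
      (((E \ free).filter (v ∈ ·)).card : ℝ) ≤ ξ * Fintype.card V)).card := by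
  set n := Fintype.card V
  have hn : (0 : ℝ) < n := by exact_mod_cast hV
  -- The saturated vertices, of which there are at most `2 * τ / ξ * n`. Hence `F` loses at most `τ
  -- * n ^ 2` edges to earlier offers and `2 * τ / ξ * n ^ 2` edges at `Z`, together at most half of
  -- its guaranteed size.
  set Z : Finset V := Finset.univ.filter fun v =>
    ξ * n ≤ (((E \ free).filter (v ∈ ·)).card : ℝ)
  have hZ : (Z.card : ℝ) * (ξ * n) ≤ 2 * (E \ free).card :=
    card_mul_le_of_le_card_incident _ _ fun z hz => (Finset.mem_filter.1 hz).2
  have hcover : F ⊆ (F ∩ free.filter (fun e => ∀ v ∈ e,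
      (((E \ free).filter (v ∈ ·)).card : ℝ) ≤ ξ * n)) ∪ (E \ free) ∪
        F.filter (fun e => ∃ z ∈ Z, z ∈ e) := by
    intro e he
    simp only [Finset.mem_union, Finset.mem_inter, Finset.mem_filter, Finset.mem_sdiff]
    by_cases hf : e ∈ free
    · by_cases hz : ∃ z ∈ Z, z ∈ e
      · exact .inr ⟨he, hz⟩
      · refine .inl (.inl ⟨he, hf, fun v hv => ?_⟩)
        by_contra! hlt
        exact hz ⟨v, Finset.mem_filter.2 ⟨Finset.mem_univ _, hlt.le⟩, hv⟩
    · exact .inl (.inr ⟨hFE he, hf⟩)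
  have hcard := (Finset.card_le_card hcover).trans ((Finset.card_union_le _ _).trans
    (add_le_add (Finset.card_union_le _ _) (card_filter_incident_le F Z)))
  have hcard' : (F.card : ℝ) ≤ (F ∩ free.filter (fun e => ∀ v ∈ e,
      (((E \ free).filter (v ∈ ·)).card : ℝ) ≤ ξ * n)).card + (E \ free).card + Z.card * n := by
    exact_mod_cast hcard
  have hZn : (Z.card : ℝ) * n ≤ 2 * τ / ξ * n ^ 2 := by
    rw [div_mul_eq_mul_div, le_div_iff₀ hξ]
    nlinarith
  nlinarith [mul_le_mul_of_nonneg_right hτε (sq_nonneg (n : ℝ))]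

/-- Waiter can force Client to hit every member of a family of dense edge sets, such that at every
vertex few edges are offered. -/
theorem canReach_transversal {b : ℕ} {ε ξ τ : ℝ} (hε : 0 ≤ ε) (hε1 : ε ≤ 4) (hξ : 0 < ξ)
    (hτε : τ + 2 * τ / ξ ≤ ε / 2) (hb : (b : ℝ) < ε / 4 * Fintype.card V ^ 2)
    (hV : 0 < Fintype.card V)
    {E : Finset (Sym2 V)} (hEV : E.card ≤ Fintype.card V ^ 2) (m : ℕ)
    {𝓢 : Finset (Finset (Sym2 V))} (hE : ∀ F ∈ 𝓢, F ⊆ E)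
    (hF : ∀ F ∈ 𝓢, ε * Fintype.card V ^ 2 ≤ F.card) {free client : Finset (Sym2 V)}
    (hm : 𝓢.card * (1 - ε / 4) ^ m < 1)
    (hused : ((E \ free).card + m * (b + 1) : ℝ) ≤ τ * Fintype.card V ^ 2)
    (hdeg : ∀ v, (((E \ free).filter (v ∈ ·)).card : ℝ) ≤ ξ * Fintype.card V + b + 1) :
    CanReach b (fun free' client' => free \ E ⊆ free' ∧
      (∀ v, (((E \ free').filter (v ∈ ·)).card : ℝ) ≤ ξ * Fintype.card V + b + 1) ∧
      ∀ F ∈ 𝓢, ∃ e ∈ F, e ∈ client') free client := by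
  induction m generalizing 𝓢 free client with
  | zero =>
    have h0 : 𝓢.card = 0 := by
      rw [pow_zero, mul_one] at hm
      exact_mod_cast Nat.lt_one_iff.1 (by exact_mod_cast hm)
    rw [Finset.card_eq_zero] at h0
    exact .done ⟨Finset.sdiff_subset, hdeg, by simp [h0]⟩
  | succ m ih =>
    rcases 𝓢.eq_empty_or_nonempty with rfl | hne
    · exact .done ⟨Finset.sdiff_subset, hdeg, by simp⟩
    set n := Fintype.card V
    have hused₀ : ((E \ free).card : ℝ) ≤ τ * n ^ 2 := by
      refine le_trans ?_ hused
      rw [le_add_iff_nonneg_right]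
      positivity
    -- Each remaining set has at least `ε / 2 * n ^ 2` allowed edges. The bound on `b` uses up less
    -- than half of this, which leaves popularity `ε / 4`.
    obtain ⟨offer, ho, hoc, hpop⟩ := exists_popular_subset (b := b) (β := ε / 4) (by linarith)
      (A := free.filter (fun e => ∀ v ∈ e,
        (((E \ free).filter (v ∈ ·)).card : ℝ) ≤ ξ * n)) (B := E) hne hE fun F hFS => by
        have h1 := card_inter_allowed_ge hξ hτε (hE F hFS) (hF F hFS) hused₀ hV
        have h2 : (E.card : ℝ) ≤ n ^ 2 := by exact_mod_cast hEV
        nlinarith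
    have hfree : offer ⊆ free :=
      ho.trans (Finset.inter_subset_left.trans (Finset.filter_subset _ _))
    have hused' : E \ (free \ offer) = (E \ free) ∪ offer := by
      ext e
      have := @ho e
      have := @hfree e
      simp only [Finset.mem_sdiff, Finset.mem_union, Finset.mem_inter] at *
      tauto
    refine .round hfree hoc fun e he => ?_
    -- Whichever edge Client takes, only the sets avoiding it survive, at most a proportion `1 - ε /
    -- 4`.
    refine (ih (𝓢 := 𝓢.filter (e ∉ ·)) (fun F hF => hE F (Finset.mem_filter.1 hF).1)
      (fun F hFS => hF F (Finset.mem_filter.1 hFS).1) ?_ ?_ ?_).mono ?_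
    · have hsum : ((𝓢.filter (e ∈ ·)).card : ℝ) + (𝓢.filter (e ∉ ·)).card = 𝓢.card := by
        exact_mod_cast Finset.card_filter_add_card_filter_not (s := 𝓢) (e ∈ ·)
      have := hpop e he
      refine lt_of_le_of_lt ?_ hm
      rw [pow_succ', ← mul_assoc]
      have : (0 : ℝ) ≤ 1 - ε / 4 := by linarith
      gcongr
      linarith
    · rw [hused']
      have := Finset.card_union_le (E \ free) offer
      rw [hoc] at this
      have h' : (((E \ free) ∪ offer).card : ℝ) ≤ (E \ free).card + (b + 1) := by
        exact_mod_cast this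
      push_cast at hused
      linarith
    · intro v
      rw [hused', Finset.filter_union]
      -- A vertex meeting the offer was unsaturated before it, so a single offer can exceed the cap
      -- `ξ * n` by at most `b + 1`.
      by_cases hv : ∃ e ∈ offer, v ∈ e
      · obtain ⟨e', he', hv⟩ := hv
        have h1 := (Finset.mem_filter.1 (Finset.mem_inter.1 (ho he')).1).2 v hv
        have h2 := Finset.card_union_le ((E \ free).filter (v ∈ ·)) (offer.filter (v ∈ ·))
        have h3 := Finset.card_filter_le offer (v ∈ ·)
        rw [hoc] at h3
        have h4 : ((((E \ free).filter (v ∈ ·)) ∪ (offer.filter (v ∈ ·))).card : ℝ) ≤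
            ((E \ free).filter (v ∈ ·)).card + (b + 1) := by
          exact_mod_cast h2.trans (by omega)
        linarith
      · push Not at hv
        rw [Finset.filter_eq_empty_iff.2 fun {x} hx => hv x hx, Finset.union_empty]
        exact hdeg v
    · rintro free' client' h1 h2 h3 ⟨h4, h5, h6⟩
      refine ⟨subset_trans ?_ h4, h5, fun F hFS => ?_⟩
      · intro x hx
        rw [Finset.mem_sdiff] at hx
        simp only [Finset.mem_sdiff]
        exact ⟨⟨hx.1, fun h => hx.2 (Finset.mem_inter.1 (ho h)).2⟩, hx.2⟩
      · by_cases heF : e ∈ F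
        · exact ⟨e, heF, h2 (Finset.mem_insert_self _ _)⟩
        · exact h6 F (Finset.mem_filter.2 ⟨hFS, heF⟩)

end WaiterClient

/-! ### Partition into parts without sparse cuts -/

namespace SimpleGraph

variable {V : Type*} (G : SimpleGraph V) [DecidableRel G.Adj]

theorem card_interedges_eq_sum (A B : Finset V) :
    (G.interedges A B).card = ∑ a ∈ A, (B.filter (G.Adj a)).card := by
  rw [interedges, Rel.interedges, Finset.card_filter, Finset.sum_product]
  exact Finset.sum_congr rfl fun a _ => (Finset.card_filter _ _).symm

variable [Fintype V]

/-- The number of ordered pairs of adjacent vertices of the same colour. -/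
def monochromatic {W : Type*} [DecidableEq W] (f : V → W) : ℕ :=
  ∑ u, ∑ w, if G.Adj u w ∧ f u = f w then 1 else 0

/-- The vertices of colour `i`. -/
def colorPart {W : Type*} [DecidableEq W] (f : V → W) (i : W) : Finset V :=
  Finset.univ.filter (f · = i)

/-- Recolour the vertices of `A` with colour `j`. -/
def recolor [DecidableEq V] {W : Type*} (f : V → W) (A : Finset V) (j : W) : V → W :=
  fun v => if v ∈ A then j else f v

variable {W : Type*} [DecidableEq W] {f : V → W}

@[simp] theorem mem_colorPart {i : W} {v : V} : v ∈ colorPart f i ↔ f v = i := by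
  simp [colorPart]

theorem sum_card_filter_colorPart (f : V → W) (v : V) :
    ∑ j ∈ Finset.univ.image f, ((colorPart f j).filter (G.Adj v)).card = G.degree v := by
  rw [← card_neighborFinset_eq_degree, Finset.card_eq_sum_card_fiberwise
    (f := f) (t := Finset.univ.image f) (fun x _ => by simp)]
  refine Finset.sum_congr rfl fun j _ => ?_
  congr 1
  ext w
  simp [and_comm]

theorem sum_card_colorPart (f : V → W) :
    ∑ j ∈ Finset.univ.image f, (colorPart f j).card = Fintype.card V := by
  rw [← Finset.card_univ, Finset.card_eq_sum_card_fiberwise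
    (f := f) (t := Finset.univ.image f) (fun x _ => by simp)]
  rfl

/-- The colour classes are disjoint, so a lower bound on their sizes bounds the number of colours
used. -/
theorem card_image_mul_le (f : V → W) {x : ℝ}
    (hx : ∀ v, x ≤ (colorPart f (f v)).card) :
    (Finset.univ.image f).card * x ≤ Fintype.card V := by
  rw [← sum_card_colorPart f, ← nsmul_eq_mul, ← Finset.sum_const]
  push_cast
  refine Finset.sum_le_sum fun j hj => ?_
  obtain ⟨v, -, rfl⟩ := Finset.mem_image.1 hj
  exact hx v

variable [DecidableEq V]

theorem sum_sum_eq_of_symm (a : V → V → ℕ) (ha : ∀ u w, a u w = a w u) (A : Finset V) :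
    ∑ u, ∑ w, a u w = ∑ u ∈ A, ∑ w ∈ A, a u w + 2 * ∑ u ∈ A, ∑ w ∈ Aᶜ, a u w +
      ∑ u ∈ Aᶜ, ∑ w ∈ Aᶜ, a u w := by
  have h1 : ∀ u, ∑ w, a u w = ∑ w ∈ A, a u w + ∑ w ∈ Aᶜ, a u w := fun u =>
    (Finset.sum_add_sum_compl A _).symm
  have h2 : ∑ u ∈ Aᶜ, ∑ w ∈ A, a u w = ∑ u ∈ A, ∑ w ∈ Aᶜ, a u w := by
    rw [Finset.sum_comm]
    exact Finset.sum_congr rfl fun u _ => Finset.sum_congr rfl fun w _ => ha _ _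
  rw [← Finset.sum_add_sum_compl A, Finset.sum_congr rfl fun u _ => h1 u,
    Finset.sum_congr (s₁ := Aᶜ) rfl fun u _ => h1 u, Finset.sum_add_distrib,
    Finset.sum_add_distrib, h2]
  ring

/-- Only pairs with exactly one vertex in `A` can change status. Such a pair loses monochromaticity
towards the rest of colour `i` and gains it towards colour `j`; ordered counting gives the factors
2. -/
theorem monochromatic_recolor {A : Finset V} {i j : W} (hA : A ⊆ colorPart f i) (hij : j ≠ i) :
    G.monochromatic (recolor f A j) + 2 * (G.interedges A (colorPart f i \ A)).card =
      G.monochromatic f + 2 * (G.interedges A (colorPart f j)).card := by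
  have hsymm : ∀ (g : V → W) (u w : V), (if G.Adj u w ∧ g u = g w then 1 else 0) =
      if G.Adj w u ∧ g w = g u then 1 else 0 := by
    intro g u w
    simp only [G.adj_comm u w, eq_comm (a := g u)]
  have hAi : ∀ v ∈ A, f v = i := fun v hv => mem_colorPart.1 (hA hv)
  rw [monochromatic, monochromatic, sum_sum_eq_of_symm _ (hsymm _) A,
    sum_sum_eq_of_symm _ (hsymm f) A]
  have h1 : ∑ u ∈ A, ∑ w ∈ A, (if G.Adj u w ∧ recolor f A j u = recolor f A j w then 1 else 0) =
      ∑ u ∈ A, ∑ w ∈ A, (if G.Adj u w ∧ f u = f w then 1 else 0) := by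
    refine Finset.sum_congr rfl fun u hu => Finset.sum_congr rfl fun w hw => ?_
    simp [recolor, hu, hw, hAi]
  have h2 : ∑ u ∈ Aᶜ, ∑ w ∈ Aᶜ, (if G.Adj u w ∧ recolor f A j u = recolor f A j w then 1 else 0) =
      ∑ u ∈ Aᶜ, ∑ w ∈ Aᶜ, (if G.Adj u w ∧ f u = f w then 1 else 0) := by
    refine Finset.sum_congr rfl fun u hu => Finset.sum_congr rfl fun w hw => ?_
    simp [recolor, Finset.mem_compl.1 hu, Finset.mem_compl.1 hw]
  have h3 : ∑ u ∈ A, ∑ w ∈ Aᶜ, (if G.Adj u w ∧ recolor f A j u = recolor f A j w then 1 else 0) =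
      (G.interedges A (colorPart f j)).card := by
    rw [card_interedges_eq_sum]
    refine Finset.sum_congr rfl fun u hu => ?_
    rw [← Finset.card_filter]
    congr 1
    ext w
    simp only [Finset.mem_filter, Finset.mem_compl, mem_colorPart, recolor, hu, if_true]
    constructor
    · rintro ⟨h1, h2, h3⟩
      rw [if_neg h1] at h3
      exact ⟨h3.symm, h2⟩
    · rintro ⟨h1, h2⟩
      have hw : w ∉ A := fun hw => hij (h1.symm.trans (hAi w hw))
      exact ⟨hw, h2, by rw [if_neg hw, h1]⟩
  have h4 : ∑ u ∈ A, ∑ w ∈ Aᶜ, (if G.Adj u w ∧ f u = f w then 1 else 0) =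
      (G.interedges A (colorPart f i \ A)).card := by
    rw [card_interedges_eq_sum]
    refine Finset.sum_congr rfl fun u hu => ?_
    rw [← Finset.card_filter]
    congr 1
    ext w
    simp only [Finset.mem_filter, Finset.mem_compl, mem_colorPart, hAi u hu, Finset.mem_sdiff]
    constructor
    · rintro ⟨h1, h2, h3⟩
      exact ⟨⟨h3.symm, h1⟩, h2⟩
    · rintro ⟨⟨h1, h2⟩, h3⟩
      exact ⟨h2, h3, h1.symm⟩
  rw [h1, h2, h3, h4]
  ring

/-- The vertices of a graph of linear minimum degree can be partitioned such that each part induces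
a subgraph of linear minimum degree that has no sparse cuts. -/
theorem exists_partition_without_sparse_cuts {α : ℝ} (hα : 0 < α) (hα1 : α ≤ 1)
    (hdeg : ∀ v, α * Fintype.card V ≤ G.degree v) (hn : 4 ≤ α * Fintype.card V) :
    ∃ f : V → Option V,
      (∀ v, α ^ 2 / 2 * Fintype.card V ≤ ((colorPart f (f v)).filter (G.Adj v)).card) ∧
      ∀ v, ∀ A ⊆ colorPart f (f v), α ^ 2 / 8 * Fintype.card V ≤ A.card →
        α ^ 2 / 8 * Fintype.card V ≤ (colorPart f (f v) \ A).card →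
        α ^ 5 / 256 * Fintype.card V ^ 2 ≤ (G.interedges A (colorPart f (f v) \ A)).card := by
  set n := Fintype.card V with hndef
  have hn0 : (0 : ℝ) < n := by
    by_contra! h
    nlinarith
  set γ : ℝ := α ^ 2 / 8 with hγ
  have hγ0 : 0 < γ := by positivity
  have hγα : γ ≤ α / 8 := by rw [hγ]; nlinarith
  set η : ℝ := α ^ 5 / 128 with hη
  have hη0 : 0 < η := by positivity
  have hηγ : η = γ ^ 2 * α / 2 := by rw [hη, hγ]; ring
  set feas : Finset (V → Option V) :=
    Finset.univ.filter fun f => ∀ v, γ * n ≤ (colorPart f (f v)).card with hfeas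
  have hmemf : ∀ f, f ∈ feas ↔ ∀ v, γ * n ≤ (colorPart f (f v)).card := by simp [hfeas]
  -- Each colour earns the bonus `η * n ^ 2`. Splitting a part is therefore profitable across a
  -- sparse cut, while merging is profitable across a dense pair. The constant colouring shows that
  -- the feasible set is nonempty.
  obtain ⟨f, hf, hmax⟩ := feas.exists_max_image
    (fun f => (G.monochromatic f : ℝ) + η * n ^ 2 * (Finset.univ.image f).card)
    ⟨fun _ => none, by
      rw [hmemf]
      intro v
      have : (colorPart (fun _ : V => (none : Option V)) none) = Finset.univ := by
        ext; simp
      rw [this, Finset.card_univ]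
      nlinarith⟩
  rw [hmemf] at hf
  set r := (Finset.univ.image f).card with hr
  have hrec : ∀ (A : Finset V) (i j : Option V), A ⊆ colorPart f i → j ≠ i →
      recolor f A j ∈ feas →
      2 * ((G.interedges A (colorPart f j)).card : ℝ) +
          η * n ^ 2 * (Finset.univ.image (recolor f A j)).card ≤
        2 * (G.interedges A (colorPart f i \ A)).card + η * n ^ 2 * r := by
    intro A i j hA hij hfe
    have h1 := hmax _ hfe
    have h2 : (G.monochromatic (recolor f A j) : ℝ) +
        2 * (G.interedges A (colorPart f i \ A)).card =
        G.monochromatic f + 2 * (G.interedges A (colorPart f j)).card := by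
      exact_mod_cast G.monochromatic_recolor hA hij
    linarith
  have hsub : ∀ (A : Finset V) (j l : Option V), Disjoint A (colorPart f l) →
      colorPart f l ⊆ colorPart (recolor f A j) l := by
    intro A j l hd v hv
    have : v ∉ A := fun h => Finset.disjoint_left.1 hd h hv
    simpa [recolor, this] using hv
  have hpartdisj : ∀ {A : Finset V} {i l : Option V}, A ⊆ colorPart f i → l ≠ i →
      Disjoint A (colorPart f l) := by
    intro A i l hA hl
    rw [Finset.disjoint_left]
    intro v hv hv'
    exact hl ((mem_colorPart.1 hv').symm.trans (mem_colorPart.1 (hA hv)))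
  -- Merging two parts gains twice the edges between them and costs at most one bonus.
  have hmerge : ∀ i ∈ Finset.univ.image f, ∀ j ∈ Finset.univ.image f, j ≠ i →
      2 * ((G.interedges (colorPart f i) (colorPart f j)).card : ℝ) ≤ η * n ^ 2 := by
    intro i hi j hj hij
    have hne : ∀ v, recolor f (colorPart f i) j v ≠ i := by
      intro v
      by_cases h : f v = i <;> simp [recolor, h, hij]
    have h := hrec _ i j subset_rfl hij (by
      rw [hmemf]
      intro v
      have hv := hne v
      set l := recolor f (colorPart f i) j v with hl
      have : l ∈ Finset.univ.image f := by
        by_cases h : f v = i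
        · simpa [hl, recolor, h] using hj
        · simp [hl, recolor, h]
      obtain ⟨w, -, hw⟩ := Finset.mem_image.1 this
      have h1 := hf w
      rw [hw] at h1
      refine h1.trans ?_
      exact_mod_cast Finset.card_le_card (hsub _ j l (hpartdisj subset_rfl hv)))
    rw [sdiff_self] at h
    have h2 : r ≤ (Finset.univ.image (recolor f (colorPart f i) j)).card + 1 := by
      have : (Finset.univ.image f).erase i ⊆ Finset.univ.image (recolor f (colorPart f i) j) := by
        intro l hl
        obtain ⟨hli, hl⟩ := Finset.mem_erase.1 hl
        obtain ⟨w, -, hw⟩ := Finset.mem_image.1 hl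
        refine Finset.mem_image.2 ⟨w, Finset.mem_univ _, ?_⟩
        have : f w ≠ i := hw ▸ hli
        rw [recolor, if_neg (by simpa using this), hw]
      have h3 := Finset.card_le_card this
      rw [Finset.card_erase_of_mem hi] at h3
      omega
    have h3 : (r : ℝ) ≤ (Finset.univ.image (recolor f (colorPart f i) j)).card + 1 := by
      exact_mod_cast h2
    simp only [Finset.bot_eq_empty, card_interedges_eq_sum, Finset.filter_empty, Finset.card_empty,
      Finset.sum_const_zero, Nat.cast_zero, mul_zero, zero_add] at h ⊢
    nlinarith [mul_le_mul_of_nonneg_left h3 (by positivity : 0 ≤ η * (n : ℝ) ^ 2)]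
  have hrγ : r * γ ≤ 1 := by
    have := card_image_mul_le f hf
    rw [← mul_assoc] at this
    exact le_of_mul_le_mul_right (by linarith) hn0
  -- A part with fewer than `α / 2 * n` vertices would send at least half of its degree sum to other
  -- parts. By `hmerge` and `hrγ` these receive at most `γ * α / 4 * n ^ 2`, half of what is needed.
  have hbig : ∀ v, α / 2 * n ≤ (colorPart f (f v)).card := by
    intro v
    by_contra! hlt
    set P := colorPart f (f v) with hP
    have h1 : ∑ j ∈ Finset.univ.image f, (G.interedges P (colorPart f j)).card =
        ∑ u ∈ P, G.degree u := by
      simp_rw [card_interedges_eq_sum]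
      rw [Finset.sum_comm]
      exact Finset.sum_congr rfl fun u _ => G.sum_card_filter_colorPart f u
    have h2 : P.card * (α * n) ≤ ∑ u ∈ P, (G.degree u : ℝ) := by
      rw [← nsmul_eq_mul, ← Finset.sum_const]
      exact Finset.sum_le_sum fun u _ => hdeg u
    have h3 : ∑ j ∈ Finset.univ.image f, ((G.interedges P (colorPart f j)).card : ℝ) ≤
        P.card * P.card + r * (η * n ^ 2 / 2) := by
      rw [← Finset.add_sum_erase _ _ (Finset.mem_image_of_mem f (Finset.mem_univ v))]
      refine add_le_add (by exact_mod_cast G.card_interedges_le_mul P P) ?_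
      calc _ ≤ ∑ j ∈ (Finset.univ.image f).erase (f v), η * (n : ℝ) ^ 2 / 2 := by
            refine Finset.sum_le_sum fun j hj => ?_
            obtain ⟨hj1, hj2⟩ := Finset.mem_erase.1 hj
            have := hmerge _ (Finset.mem_image_of_mem f (Finset.mem_univ v)) j hj2 hj1
            rw [← hP] at this
            linarith
        _ ≤ _ := by
            rw [Finset.sum_const, nsmul_eq_mul]
            have : (((Finset.univ.image f).erase (f v)).card : ℝ) ≤ r := by
              exact_mod_cast Finset.card_le_card (Finset.erase_subset _ _)
            gcongr
    have h4 : P.card * (α * n) ≤ P.card * P.card + r * (η * (n : ℝ) ^ 2 / 2) := by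
      refine h2.trans (le_trans (le_of_eq ?_) h3)
      exact_mod_cast h1.symm
    have h5 : γ * n ≤ P.card := hf v
    have h6 : r * (η * (n : ℝ) ^ 2 / 2) ≤ γ * α / 4 * n ^ 2 := by
      have : r * (η * (n : ℝ) ^ 2 / 2) = (r * γ) * (γ * α / 4 * n ^ 2) := by rw [hηγ]; ring
      rw [this]
      exact mul_le_of_le_one_left (by positivity) hrγ
    have h7 : (P.card : ℝ) * (α / 2 * n) ≤ P.card * (α * n - P.card) := by
      gcongr
      linarith
    have h8 : γ * n * (α / 2 * n) ≤ P.card * (α / 2 * n) := by gcongr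
    nlinarith [mul_pos (mul_pos hγ0 hα) (pow_pos hn0 2)]
  have hrα : r * α ≤ 2 := by
    have := card_image_mul_le f hbig
    rw [← mul_assoc] at this
    have := le_of_mul_le_mul_right (by linarith : r * (α / 2) * (n : ℝ) ≤ 1 * n) hn0
    linarith
  refine ⟨f, fun v => ?_, fun v A hA hAc hBc => ?_⟩
  -- Moving a single vertex is feasible because `hbig` leaves room above the threshold `γ * n`. So
  -- each vertex has at least as many neighbours in its own part as in any other, and averaging over
  -- at most `2 / α` parts gives the degree bound.
  · have hmove : ∀ j ∈ Finset.univ.image f,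
        (((colorPart f j).filter (G.Adj v)).card : ℝ) ≤
          ((colorPart f (f v)).filter (G.Adj v)).card := by
      intro j hj
      rcases eq_or_ne j (f v) with rfl | hij
      · rfl
      have hA : {v} ⊆ colorPart f (f v) := by simp
      have hcardpart : γ * n ≤ (colorPart f (f v) \ {v}).card := by
        rw [Finset.card_sdiff_of_subset hA, Finset.card_singleton,
          Nat.cast_sub (Finset.card_pos.2 ⟨v, by simp⟩)]
        have := hbig v
        push_cast
        nlinarith
      have hpos : (0 : ℝ) < (colorPart f (f v) \ {v}).card := lt_of_lt_of_le (by positivity) hcardpart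
      have hstay : colorPart f (f v) \ {v} ⊆ colorPart (recolor f {v} j) (f v) := by
        intro w hw
        simp only [Finset.mem_sdiff, Finset.mem_singleton, mem_colorPart] at hw
        simp [recolor, hw]
      have hlarge : ∀ l ∈ Finset.univ.image f, γ * n ≤ (colorPart (recolor f {v} j) l).card := by
        intro l hl
        obtain ⟨w, -, rfl⟩ := Finset.mem_image.1 hl
        by_cases hw : f w = f v
        · rw [hw]
          exact hcardpart.trans (by exact_mod_cast Finset.card_le_card hstay)
        · exact (hf w).trans (by exact_mod_cast Finset.card_le_card (hsub _ j _ (hpartdisj hA hw)))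
      have h := hrec {v} (f v) j hA hij (by
        rw [hmemf]
        intro w
        refine hlarge _ ?_
        by_cases hw : w = v
        · simpa [recolor, hw] using hj
        · simp [recolor, hw])
      have h2 : r ≤ (Finset.univ.image (recolor f {v} j)).card := by
        refine Finset.card_le_card fun l hl => ?_
        have : (0 : ℝ) < (colorPart (recolor f {v} j) l).card :=
          lt_of_lt_of_le (by positivity) (hlarge l hl)
        obtain ⟨w, hw⟩ := Finset.card_pos.1 (by exact_mod_cast this)
        exact Finset.mem_image.2 ⟨w, Finset.mem_univ _, mem_colorPart.1 hw⟩
      have h3 : (r : ℝ) ≤ (Finset.univ.image (recolor f {v} j)).card := by exact_mod_cast h2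
      have h4 := mul_le_mul_of_nonneg_left h3 (by positivity : 0 ≤ η * (n : ℝ) ^ 2)
      simp only [card_interedges_eq_sum, Finset.sum_singleton] at h
      have h5 : (((colorPart f (f v) \ {v}).filter (G.Adj v)).card : ℝ) ≤
          ((colorPart f (f v)).filter (G.Adj v)).card := by
        exact_mod_cast Finset.card_le_card (Finset.filter_subset_filter _ Finset.sdiff_subset)
      linarith
    have h1 : (G.degree v : ℝ) ≤ r * ((colorPart f (f v)).filter (G.Adj v)).card := by
      rw [← G.sum_card_filter_colorPart f v, hr, ← nsmul_eq_mul, ← Finset.sum_const]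
      push_cast
      exact Finset.sum_le_sum hmove
    have h2 := hdeg v
    have h3 := mul_le_mul_of_nonneg_right hrα
      (Nat.cast_nonneg (α := ℝ) ((colorPart f (f v)).filter (G.Adj v)).card)
    nlinarith
  -- `Option V` has one colour more than there are vertices, so an unused one is available for
  -- splitting off `A`. The split earns a bonus, hence the cut must contain at least `η / 2 * n ^ 2`
  -- edges.
  · obtain ⟨j, hj⟩ : ∃ j, j ∉ Finset.univ.image f := by
      by_contra! hall
      have h1 : Fintype.card (Option V) ≤ (Finset.univ.image f).card := by
        rw [← Finset.card_univ]
        exact Finset.card_le_card fun j _ => hall j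
      have h2 : (Finset.univ.image f).card ≤ Fintype.card V := Finset.card_image_le
      rw [Fintype.card_option] at h1
      omega
    have hjf : ∀ w, f w ≠ j := fun w hw => hj (hw ▸ Finset.mem_image_of_mem f (Finset.mem_univ w))
    have hAj : A ⊆ colorPart (recolor f A j) j := fun w hw => by simp [recolor, hw]
    have hB : colorPart f (f v) \ A ⊆ colorPart (recolor f A j) (f v) := by
      intro w hw
      rw [Finset.mem_sdiff, mem_colorPart] at hw
      simp [recolor, hw]
    have hlarge : ∀ l ∈ insert j (Finset.univ.image f),
        γ * n ≤ (colorPart (recolor f A j) l).card := by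
      intro l hl
      rcases Finset.mem_insert.1 hl with rfl | hl
      · exact hAc.trans (by exact_mod_cast Finset.card_le_card hAj)
      obtain ⟨w, -, rfl⟩ := Finset.mem_image.1 hl
      by_cases hw : f w = f v
      · rw [hw]
        exact hBc.trans (by exact_mod_cast Finset.card_le_card hB)
      · exact (hf w).trans (by exact_mod_cast Finset.card_le_card (hsub _ j _ (hpartdisj hA hw)))
    have h := hrec A (f v) j hA (hjf v).symm (by
      rw [hmemf]
      intro w
      refine hlarge _ ?_
      by_cases hw : w ∈ A <;> simp [recolor, hw])
    have h2 : r + 1 ≤ (Finset.univ.image (recolor f A j)).card := by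
      rw [hr, ← Finset.card_insert_of_notMem hj]
      refine Finset.card_le_card fun l hl => ?_
      have : (0 : ℝ) < (colorPart (recolor f A j) l).card :=
        lt_of_lt_of_le (by positivity) (hlarge l hl)
      obtain ⟨w, hw⟩ := Finset.card_pos.1 (by exact_mod_cast this)
      exact Finset.mem_image.2 ⟨w, Finset.mem_univ _, mem_colorPart.1 hw⟩
    have h3 : (r : ℝ) + 1 ≤ (Finset.univ.image (recolor f A j)).card := by exact_mod_cast h2
    have h4 := mul_le_mul_of_nonneg_left h3 (by positivity : 0 ≤ η * (n : ℝ) ^ 2)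
    have h5 : (0 : ℝ) ≤ (G.interedges A (colorPart f j)).card := by positivity
    have h6 : η = 2 * (α ^ 5 / 256) := by rw [hη]; ring
    rw [h6] at h h4
    linarith

end SimpleGraph

/-! ### Highly connected cores and vertex-connectivity -/

namespace SimpleGraph

/-- The set of vertices reachable from `u` would otherwise form one side of a cut crossed by no
edge. -/
theorem preconnected_induce_of_forall_cut {V : Type*} [DecidableEq V] (H : SimpleGraph V)
    (W : Finset V)
    (h : ∀ A B : Finset V, A.Nonempty → B.Nonempty → Disjoint A B → A ∪ B = W →
      ∃ a ∈ A, ∃ b ∈ B, H.Adj a b) : (H.induce (W : Set V)).Preconnected := by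
  classical
  intro u v
  by_contra hnr
  set A : Finset V := W.filter fun x => ∃ hx : x ∈ (W : Set V), (H.induce (W : Set V)).Reachable u ⟨x, hx⟩
    with hA
  obtain ⟨a, ha, b, hb, hab⟩ := h A (W \ A)
    ⟨u, Finset.mem_filter.2 ⟨u.2, u.2, .rfl⟩⟩
    ⟨v, Finset.mem_sdiff.2 ⟨v.2, fun hv => hnr (Finset.mem_filter.1 hv).2.2⟩⟩
    Finset.disjoint_sdiff (Finset.union_sdiff_of_subset (Finset.filter_subset _ _))
  obtain ⟨-, haW, hua⟩ := Finset.mem_filter.1 ha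
  obtain ⟨hbW, hbA⟩ := Finset.mem_sdiff.1 hb
  refine hbA (Finset.mem_filter.2 ⟨hbW, hbW, hua.trans (Adj.reachable ?_)⟩)
  exact hab

variable {V : Type*} (G : SimpleGraph V) [DecidableRel G.Adj]

theorem card_interedges_swap (A B : Finset V) :
    (G.interedges A B).card = (G.interedges B A).card :=
  haveI := G.symm
  Rel.card_interedges_comm A B

variable [DecidableEq V]

theorem card_mul_le_card_interedges {A B P : Finset V} {d x : ℝ}
    (hd : ∀ v ∈ A, d ≤ (P.filter (G.Adj v)).card) (hB : ((P \ B).card : ℝ) ≤ x) :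
    A.card * (d - x) ≤ (G.interedges A B).card := by
  rw [card_interedges_eq_sum, ← nsmul_eq_mul, ← Finset.sum_const]
  push_cast
  refine Finset.sum_le_sum fun a ha => ?_
  have h1 : P.filter (G.Adj a) ⊆ B.filter (G.Adj a) ∪ (P \ B) := by
    intro w hw
    obtain ⟨hwP, hw⟩ := Finset.mem_filter.1 hw
    by_cases hwB : w ∈ B <;> simp [hwP, hw, hwB]
  have h2 : ((P.filter (G.Adj a)).card : ℝ) ≤ (B.filter (G.Adj a)).card + (P \ B).card := by
    exact_mod_cast (Finset.card_le_card h1).trans (Finset.card_union_le _ _)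
  linarith [hd a ha]

/-- The set `P` induces a subgraph of minimum degree at least `δ * n` such that there are at least
`η * n ^ 2` edges between any two sides of a partition of `P` of size at least `γ * n` each. -/
structure IsDensePart (n δ γ η : ℝ) (P : Finset V) : Prop where
  degree_ge : ∀ v ∈ P, δ * n ≤ (P.filter (G.Adj v)).card
  cut_ge : ∀ A ⊆ P, γ * n ≤ A.card → γ * n ≤ (P \ A).card →
    η * n ^ 2 ≤ (G.interedges A (P \ A)).card

variable {G} {n δ γ η θ ε : ℝ} {P : Finset V}

theorem IsDensePart.card_interedges_ge (hP : G.IsDensePart n δ γ η P) (hPn : (P.card : ℝ) ≤ n)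
    (hn : 0 ≤ n) (hδ : 0 ≤ δ) (hγθ : γ + 2 * θ ≤ δ / 2) (hεθ : ε ≤ θ * δ / 2)
    (hεη : ε + 2 * θ ≤ η) {A B : Finset V} (hA : A ⊆ P) (hB : B ⊆ P) (hAB : Disjoint A B)
    (hrest : ((P \ (A ∪ B)).card : ℝ) ≤ 2 * θ * n) (hAc : θ * n ≤ A.card) (hBc : θ * n ≤ B.card) :
    ε * n ^ 2 ≤ (G.interedges A B).card := by
  -- A side below `γ * n` is treated by minimum degree: each of its vertices has at most `(γ + 2 *
  -- θ) * n` neighbours outside `B`, at most half of its degree bound. Two larger sides are treated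
  -- by the cut condition, after discarding edges to the few vertices outside `A ∪ B`.
  have hsmall : ∀ A B : Finset V, A ⊆ P → ((P \ (A ∪ B)).card : ℝ) ≤ 2 * θ * n →
      θ * n ≤ A.card → (A.card : ℝ) < γ * n → ε * n ^ 2 ≤ (G.interedges A B).card := by
    intro A B hA hrest hAc hAγ
    have h1 : ((P \ B).card : ℝ) ≤ γ * n + 2 * θ * n := by
      have : P \ B ⊆ A ∪ (P \ (A ∪ B)) := by
        intro w hw
        rw [Finset.mem_sdiff] at hw
        by_cases hwA : w ∈ A <;> simp [hw, hwA]
      have : ((P \ B).card : ℝ) ≤ A.card + (P \ (A ∪ B)).card := by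
        exact_mod_cast (Finset.card_le_card this).trans (Finset.card_union_le _ _)
      linarith
    have h2 := G.card_mul_le_card_interedges (fun v hv => hP.degree_ge v (hA hv)) h1
    have h3 : δ / 2 * n ≤ δ * n - (γ * n + 2 * θ * n) := by
      nlinarith [mul_le_mul_of_nonneg_right hγθ hn]
    calc ε * n ^ 2 ≤ θ * δ / 2 * n ^ 2 := by gcongr
      _ = θ * n * (δ / 2 * n) := by ring
      _ ≤ A.card * (δ * n - (γ * n + 2 * θ * n)) := by gcongr
      _ ≤ _ := h2
  by_cases hAγ : (A.card : ℝ) < γ * n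
  · exact hsmall A B hA hrest hAc hAγ
  by_cases hBγ : (B.card : ℝ) < γ * n
  · rw [card_interedges_swap]
    exact hsmall B A hB (by rwa [Finset.union_comm]) hBc hBγ
  push Not at hAγ hBγ
  have hBP : B ⊆ P \ A := fun w hw =>
    Finset.mem_sdiff.2 ⟨hB hw, fun h => Finset.disjoint_left.1 hAB h hw⟩
  have h1 := hP.cut_ge A hA hAγ (hBγ.trans (by exact_mod_cast Finset.card_le_card hBP))
  have h2 : G.interedges A (P \ A) ⊆ G.interedges A B ∪ G.interedges A (P \ (A ∪ B)) := by
    rintro ⟨a, w⟩ hw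
    simp only [Finset.mem_union, mem_interedges_iff, Finset.mem_sdiff, not_or] at hw ⊢
    tauto
  have h3 : ((G.interedges A (P \ A)).card : ℝ) ≤
      (G.interedges A B).card + A.card * (P \ (A ∪ B)).card := by
    exact_mod_cast (Finset.card_le_card h2).trans ((Finset.card_union_le _ _).trans
      (add_le_add_right (G.card_interedges_le_mul _ _) _))
  have h4 : (A.card : ℝ) * (P \ (A ∪ B)).card ≤ n * (2 * θ * n) := by
    have : (A.card : ℝ) ≤ n := le_trans (by exact_mod_cast Finset.card_le_card hA) hPn
    gcongr
  nlinarith [mul_le_mul_of_nonneg_right hεη (sq_nonneg n)]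

/-- If a graph `H` meets all dense edge sets between subsets of a dense part, then after deletion of
few vertices of this part it induces there a graph that remains connected after deletion of fewer
than `k` vertices. -/
theorem IsDensePart.exists_highlyConnected_core (hP : G.IsDensePart n δ γ η P)
    (hPn : (P.card : ℝ) ≤ n) (hn : 0 < n) (hθ : 0 < θ) (hδ : 0 ≤ δ) (hγθ : γ + 2 * θ ≤ δ / 2)
    (hεθ : ε ≤ θ * δ / 2) (hεη : ε + 2 * θ ≤ η) {k : ℕ} (hk : (k : ℝ) ≤ θ * n)
    (hkθ : 2 * (k + 1) * θ ≤ δ / 2) (H : SimpleGraph V)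
    (hH : ∀ A B : Finset V, A ⊆ P → B ⊆ P → Disjoint A B →
      ε * n ^ 2 ≤ (G.interedges A B).card → ∃ a ∈ A, ∃ b ∈ B, H.Adj a b) :
    ∃ D ⊆ P, (D.card : ℝ) ≤ θ * n ∧
      ∀ S : Finset V, S.card < k → (H.induce (((P \ D) \ S : Finset V) : Set V)).Preconnected := by
  classical
  set N : Finset V → Finset V := fun D => (P \ D).filter fun w => ∃ d ∈ D, H.Adj d w with hN
  -- Poorly expanding sets: those with at most `k` outer neighbours per element on average. A
  -- largest one is deleted. The limit `2 * θ * n` leaves room to enlarge it once its size is shown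
  -- to be below `θ * n`.
  set 𝓓 : Finset (Finset V) :=
    P.powerset.filter fun D => (D.card : ℝ) ≤ 2 * θ * n ∧ (N D).card ≤ k * D.card with h𝓓
  obtain ⟨D, hD, hDmax⟩ := 𝓓.exists_max_image Finset.card ⟨∅, by simp [h𝓓, hN]; positivity⟩
  obtain ⟨hDP, hDc, hDN⟩ : D ⊆ P ∧ (D.card : ℝ) ≤ 2 * θ * n ∧ (N D).card ≤ k * D.card := by
    simpa [h𝓓] using hD
  have hDsmall : (D.card : ℝ) < θ * n := by
    -- A poorly expanding set of size at least `θ * n` has no `H`-edge to the rest of the part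
    -- beyond its neighbourhood, although `G` has a dense edge set there, which `H` must hit.
    by_contra! hlt
    have h1 : ((P \ ((P \ D) \ N D)).card : ℝ) ≤ 2 * (k + 1) * θ * n := by
      have : P \ ((P \ D) \ N D) ⊆ D ∪ N D := by
        intro w hw
        simp only [Finset.mem_sdiff, Finset.mem_union] at hw ⊢
        tauto
      have : ((P \ ((P \ D) \ N D)).card : ℝ) ≤ D.card + k * D.card := by
        exact_mod_cast (Finset.card_le_card this).trans ((Finset.card_union_le _ _).trans
          (add_le_add_right hDN _))
      nlinarith [mul_le_mul_of_nonneg_left hDc (by positivity : (0 : ℝ) ≤ k + 1)]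
    have h2 := G.card_mul_le_card_interedges (fun v hv => hP.degree_ge v (hDP hv)) h1
    obtain ⟨a, ha, b, hb, hab⟩ := hH D ((P \ D) \ N D) hDP
      (Finset.sdiff_subset.trans Finset.sdiff_subset)
      (Finset.disjoint_left.2 fun w hw hw' =>
        (Finset.mem_sdiff.1 (Finset.mem_sdiff.1 hw').1).2 hw) (by
        refine le_trans ?_ h2
        calc ε * n ^ 2 ≤ θ * δ / 2 * n ^ 2 := by gcongr
          _ = θ * n * (δ / 2 * n) := by ring
          _ ≤ D.card * (δ * n - 2 * (k + 1) * θ * n) := by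
              gcongr
              nlinarith [mul_le_mul_of_nonneg_right hkθ hn.le])
    obtain ⟨hb1, hb2⟩ := Finset.mem_sdiff.1 hb
    exact hb2 (Finset.mem_filter.2 ⟨hb1, a, ha, hab⟩)
  refine ⟨D, hDP, hDsmall.le, fun S hS => H.preconnected_induce_of_forall_cut _ ?_⟩
  intro A B hA hB hAB hU
  by_contra! hno
  have key : ∀ A B : Finset V, A.Nonempty → A ∪ B = (P \ D) \ S →
      (∀ a ∈ A, ∀ b ∈ B, ¬ H.Adj a b) → θ * n ≤ A.card := by
    intro A B hA hU hno
    by_contra! hlt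
    have hAsub : ∀ w ∈ A, w ∈ P ∧ w ∉ D := fun w hw => by
      have := hU ▸ Finset.mem_union_left B hw
      simp only [Finset.mem_sdiff] at this
      exact this.1
    have hdisj : Disjoint D A := Finset.disjoint_right.2 fun w hw => (hAsub w hw).2
    have hcard := Finset.card_union_of_disjoint hdisj
    have hApos := hA.card_pos
    have hmem : D ∪ A ∈ 𝓓 := by
      refine Finset.mem_filter.2 ⟨Finset.mem_powerset.2
        (Finset.union_subset hDP fun w hw => (hAsub w hw).1), ?_, ?_⟩
      · rw [hcard]
        push_cast
        linarith
      -- As `A` has no edge to `B`, new outer neighbours lie in `S`. Since `S` has fewer than `k`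
      -- elements and `A` is nonempty, `D ∪ A` would again expand poorly, against the maximality of
      -- `D`.
      · have h1 : N (D ∪ A) ⊆ N D ∪ S := by
          intro w hw
          obtain ⟨hw1, d, hd, hdw⟩ := Finset.mem_filter.1 hw
          rw [Finset.mem_sdiff, Finset.mem_union, not_or] at hw1
          rcases Finset.mem_union.1 hd with hd | hd
          · exact Finset.mem_union_left _ (Finset.mem_filter.2
              ⟨Finset.mem_sdiff.2 ⟨hw1.1, hw1.2.1⟩, d, hd, hdw⟩)
          · refine Finset.mem_union_right _ ?_
            by_contra hwS
            have hwU : w ∈ A ∪ B := by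
              rw [hU]
              simp [hw1, hwS]
            rcases Finset.mem_union.1 hwU with h | h
            · exact hw1.2.2 h
            · exact hno d hd w h hdw
        calc (N (D ∪ A)).card ≤ (N D).card + S.card :=
              (Finset.card_le_card h1).trans (Finset.card_union_le _ _)
          _ ≤ k * D.card + k * A.card := by
              refine add_le_add hDN (hS.le.trans ?_)
              exact Nat.le_mul_of_pos_right _ hApos
          _ = k * (D ∪ A).card := by rw [hcard]; ring
    have := hDmax _ hmem
    omega
  have hAc := key A B hA hU hno
  have hBc := key B A hB (by rwa [Finset.union_comm]) fun b hb a ha hab =>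
    hno a ha b hb hab.symm
  have hsub : ∀ w ∈ A ∪ B, w ∈ P := fun w hw => by
    rw [hU] at hw
    exact (Finset.mem_sdiff.1 (Finset.mem_sdiff.1 hw).1).1
  have hAP : A ⊆ P := fun w hw => hsub w (Finset.mem_union_left _ hw)
  have hBP : B ⊆ P := fun w hw => hsub w (Finset.mem_union_right _ hw)
  have hrest : ((P \ (A ∪ B)).card : ℝ) ≤ 2 * θ * n := by
    have h1 : P \ (A ∪ B) ⊆ D ∪ S := by
      rw [hU]
      intro w hw
      simp only [Finset.mem_sdiff, Finset.mem_union] at hw ⊢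
      tauto
    have h2 : ((P \ (A ∪ B)).card : ℝ) ≤ D.card + S.card := by
      exact_mod_cast (Finset.card_le_card h1).trans (Finset.card_union_le _ _)
    have h3 : (S.card : ℝ) ≤ k := by exact_mod_cast hS.le
    linarith
  obtain ⟨a, ha, b, hb, hab⟩ := hH A B hAP hBP hAB
    (hP.card_interedges_ge hPn hn.le hδ hγθ hεθ hεη hAP hBP hAB hrest hAc hBc)
  exact hno a ha b hb hab

/-- A graph is `k`-vertex-connected if its vertex set is partitioned into parts with highly
connected cores, every other vertex has `k` neighbours in the core of its part, and there are `k`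
disjoint edges from every part to a fixed part. -/
theorem isVertexConnected_of_cores [Fintype V] {W : Type*} [DecidableEq W] {k : ℕ}
    {H : SimpleGraph V} [DecidableRel H.Adj]
    (hk : k < Fintype.card V) {f : V → W} {D : W → Finset V} (v₀ : V)
    (hcore : ∀ v, ∀ S : Finset V, S.card < k →
      (H.induce (((colorPart f (f v) \ D (f v)) \ S : Finset V) : Set V)).Preconnected)
    (hcard : ∀ v, k ≤ (colorPart f (f v) \ D (f v)).card)
    (hD : ∀ v ∈ D (f v), k ≤ ((colorPart f (f v) \ D (f v)).filter (H.Adj v)).card)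
    (hlink : ∀ v, f v ≠ f v₀ → ∃ x y : Fin k → V, x.Injective ∧ y.Injective ∧
      ∀ s, f (x s) = f v ∧ f (y s) = f v₀ ∧ H.Adj (x s) (y s)) :
    H.IsVertexConnected k := by
  classical
  refine ⟨hk, fun S hS => ?_⟩
  set U : Set V := {v : V | v ∉ S} with hU
  have hcorepair : ∀ v w (hv : v ∈ U) (hw : w ∈ U), f w = f v → v ∉ D (f v) → w ∉ D (f v) →
      (H.induce U).Reachable ⟨v, hv⟩ ⟨w, hw⟩ := by
    intro v w hv hw hfw hvD hwD
    have hle : (((colorPart f (f v) \ D (f v)) \ S : Finset V) : Set V) ≤ U := by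
      intro z hz
      exact (Finset.mem_sdiff.1 hz).2
    have := hcore v S hS ⟨v, by simp_all⟩ ⟨w, by simp_all⟩
    exact this.map (induceHomOfLE H hle).toHom
  have hpick : ∀ T : Finset V, k ≤ T.card → ∃ t ∈ T, t ∈ U := fun T hT => by
    by_contra! hall
    have : T ⊆ S := fun t ht => by simpa [hU] using hall t ht
    have := Finset.card_le_card this
    omega
  have htocore : ∀ v (hv : v ∈ U), ∃ w, ∃ hw : w ∈ U, f w = f v ∧ w ∉ D (f v) ∧
      (H.induce U).Reachable ⟨v, hv⟩ ⟨w, hw⟩ := by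
    intro v hv
    by_cases hvD : v ∈ D (f v)
    · obtain ⟨w, hw, hwU⟩ := hpick _ (hD v hvD)
      simp only [Finset.mem_filter, Finset.mem_sdiff, mem_colorPart] at hw
      exact ⟨w, hwU, hw.1.1, hw.1.2, Adj.reachable (by exact hw.2)⟩
    · exact ⟨v, hv, rfl, hvD, .rfl⟩
  have hpart : ∀ v w (hv : v ∈ U) (hw : w ∈ U), f w = f v →
      (H.induce U).Reachable ⟨v, hv⟩ ⟨w, hw⟩ := by
    intro v w hv hw hfw
    obtain ⟨v', hv', hv1, hv2, hv3⟩ := htocore v hv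
    obtain ⟨w', hw', hw1, hw2, hw3⟩ := htocore w hw
    refine hv3.trans ((hcorepair v' w' hv' hw' ?_ ?_ ?_).trans hw3.symm)
    · rw [hw1, hv1, hfw]
    · rwa [hv1]
    · rwa [hv1, ← hfw]
  obtain ⟨r, hr, hrU⟩ := hpick _ (hcard v₀)
  have hrf : f r = f v₀ := mem_colorPart.1 (Finset.mem_sdiff.1 hr).1
  have hroot : ∀ v (hv : v ∈ U), (H.induce U).Reachable ⟨v, hv⟩ ⟨r, hrU⟩ := by
    intro v hv
    by_cases hfv : f v = f v₀
    · exact hpart v r hv hrU (hrf.trans hfv.symm)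
    obtain ⟨x, y, hx, hy, hxy⟩ := hlink v hfv
    obtain ⟨s, hs1, hs2⟩ : ∃ s, x s ∉ S ∧ y s ∉ S := by
      by_contra! hall
      -- If `S` met all `k` linking edges, choosing one deleted end of each would give `k` distinct
      -- vertices of `S`; ends on different sides differ because they have different colours.
      have hinj : Function.Injective fun s => if x s ∈ S then x s else y s := by
        intro s t hst
        dsimp only at hst
        split_ifs at hst
        · exact hx hst
        · exact absurd ((hxy s).1.symm.trans (hst ▸ (hxy t).2.1)) hfv
        · exact absurd ((hxy t).1.symm.trans (hst ▸ (hxy s).2.1)) hfv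
        · exact hy hst
      have h1 : (Finset.univ.image fun s => if x s ∈ S then x s else y s) ⊆ S := by
        intro z hz
        obtain ⟨s, -, rfl⟩ := Finset.mem_image.1 hz
        split_ifs with h
        · exact h
        · exact hall s h
      have h2 := Finset.card_le_card h1
      rw [Finset.card_image_of_injective _ hinj, Finset.card_univ, Fintype.card_fin] at h2
      omega
    refine (hpart v (x s) hv hs1 (hxy s).1).trans (.trans (v := ⟨y s, hs2⟩) (Adj.reachable ?_)
      (hpart (y s) r hs2 hrU (hrf.trans (hxy s).2.1.symm)))
    exact (hxy s).2.2
  exact { preconnected := fun a b => (hroot a a.2).trans (hroot b b.2).symm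
          nonempty := ⟨⟨r, hrU⟩⟩ }

end SimpleGraph

/-! ### Lower tail of the binomial random graph -/

namespace ProbabilityTheory

open MeasureTheory

/-- An exponential moment bound: the indicator of at most `b` successes in `E` is at most `2 ^ b`
times `1 / 2` to the number of successes. The expectation of the latter power factorises, with
factor `1 - p / 2` for each element of `E`. -/
theorem setBernoulli_real_card_filter_mem_le {ι : Type*} [Fintype ι] [DecidableEq ι]
    (U E : Finset ι) (hE : E ⊆ U) (p : unitInterval) (b : ℕ) [∀ s : Set ι, DecidablePred (· ∈ s)] :
    (setBernoulli (U : Set ι) p).real {s | (E.filter (· ∈ s)).card ≤ b} ≤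
      2 ^ b * (1 - (p : ℝ) / 2) ^ E.card := by
  set q : ℝ := p.1
  have hq0 : 0 ≤ q := p.2.1
  have hq1 : 0 ≤ 1 - q := sub_nonneg.2 p.2.2
  set T : Finset (Finset ι) := U.powerset.filter fun t => (E ∩ t).card ≤ b with hT
  have hcover : {s ∈ {s : Set ι | (E.filter (· ∈ s)).card ≤ b} | s ⊆ (U : Set ι)} ⊆
      ⋃ t ∈ T, {(t : Set ι)} := by
    rintro s ⟨hs, hsU⟩
    have hst : (Finset.univ.filter (· ∈ s) : Finset ι) = s := by ext; simp
    refine Set.mem_biUnion (x := Finset.univ.filter (· ∈ s)) ?_ hst.symm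
    refine Finset.mem_filter.2 ⟨Finset.mem_powerset.2 fun x hx => hsU (by simpa using hx), ?_⟩
    refine le_trans (le_of_eq ?_) hs
    congr 1
    ext
    simp
  calc (setBernoulli (U : Set ι) p).real {s | (E.filter (· ∈ s)).card ≤ b}
      = (setBernoulli (U : Set ι) p).real
          {s ∈ {s : Set ι | (E.filter (· ∈ s)).card ≤ b} | s ⊆ (U : Set ι)} := by
        rw [measureReal_def, measureReal_def, setBernoulli_apply_eq_apply_subsets]
    _ ≤ (setBernoulli (U : Set ι) p).real (⋃ t ∈ T, {(t : Set ι)}) :=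
        measureReal_mono hcover (measure_ne_top _ _)
    _ ≤ ∑ t ∈ T, (setBernoulli (U : Set ι) p).real {(t : Set ι)} :=
        measureReal_biUnion_finset_le _ _
    _ ≤ ∑ t ∈ T, 2 ^ b * ((∏ e ∈ t, q * if e ∈ E then 1 / 2 else 1) * ∏ e ∈ U \ t, (1 - q)) := by
        refine Finset.sum_le_sum fun t ht => ?_
        obtain ⟨htU, htb⟩ := Finset.mem_filter.1 ht
        rw [Finset.mem_powerset] at htU
        rw [setBernoulli_real_singleton p (by exact_mod_cast htU) U.finite_toSet]
        have h1 : ((U : Set ι) \ t).ncard = (U \ t).card := by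
          rw [← Finset.coe_sdiff, Set.ncard_coe_finset]
        rw [h1, Set.ncard_coe_finset, Finset.prod_mul_distrib, Finset.prod_const,
          Finset.prod_const, Finset.prod_ite, Finset.prod_const, Finset.prod_const_one, mul_one]
        have h2 : (t.filter (· ∈ E)).card ≤ b := by
          refine le_trans (le_of_eq ?_) htb
          congr 1
          ext
          simp [and_comm]
        have h3 : (1 : ℝ) ≤ 2 ^ b * (1 / 2) ^ (t.filter (· ∈ E)).card := by
          rw [one_div, inv_pow, ← div_eq_mul_inv, le_div_iff₀ (by positivity), one_mul]
          exact pow_le_pow_right₀ (by norm_num) h2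
        calc q ^ t.card * (1 - q) ^ (U \ t).card
            = 1 * (q ^ t.card * (1 - q) ^ (U \ t).card) := by ring
          _ ≤ 2 ^ b * (1 / 2) ^ (t.filter (· ∈ E)).card *
              (q ^ t.card * (1 - q) ^ (U \ t).card) := by gcongr
          _ = _ := by ring
    _ ≤ ∑ t ∈ U.powerset,
          2 ^ b * ((∏ e ∈ t, q * if e ∈ E then 1 / 2 else 1) * ∏ e ∈ U \ t, (1 - q)) := by
        refine Finset.sum_le_sum_of_subset_of_nonneg (Finset.filter_subset _ _) fun t _ _ => ?_
        refine mul_nonneg (by positivity) (mul_nonneg (Finset.prod_nonneg fun e _ => ?_)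
          (Finset.prod_nonneg fun _ _ => hq1))
        split_ifs <;> positivity
    _ = 2 ^ b * ∏ e ∈ U, ((q * if e ∈ E then 1 / 2 else 1) + (1 - q)) := by
        rw [← Finset.mul_sum, Finset.prod_add]
    _ = 2 ^ b * (1 - q / 2) ^ E.card := by
        congr 1
        rw [← Finset.prod_const, ← Finset.prod_subset hE (fun e _ he => by simp [he])]
        refine Finset.prod_congr rfl fun e he => ?_
        rw [if_pos he]
        ring

end ProbabilityTheory

namespace SimpleGraph

open MeasureTheory

/-- A Chernoff bound for the number of edges of a binomial random graph in a fixed set. -/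
theorem binomialRandom_real_card_filter_le {V : Type*} [Fintype V] [DecidableEq V]
    (E : Finset (Sym2 V)) (hE : ∀ e ∈ E, ¬ e.IsDiag) (p : unitInterval) (b : ℕ)
    [∀ s : Set (Sym2 V), DecidablePred (· ∈ s)] :
    (binomialRandom V p).real {G : SimpleGraph V | (E.filter (· ∈ G.edgeSet)).card ≤ b} ≤
      2 ^ b * Real.exp (-(p * E.card / 2)) := by
  have hU : ((Finset.univ.filter fun e : Sym2 V => ¬ e.IsDiag : Finset (Sym2 V)) :
      Set (Sym2 V)) = Sym2.diagSetᶜ := by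
    ext e
    simp
  have hp1 : (0 : ℝ) ≤ 1 - p / 2 := by linarith [p.2.2]
  calc _ = (ProbabilityTheory.setBernoulli (Sym2.diagSetᶜ : Set (Sym2 V)) p).real
        (edgeSet '' {G : SimpleGraph V | (E.filter (· ∈ G.edgeSet)).card ≤ b}) := by
        rw [measureReal_def, binomialRandom_apply', measureReal_def]
    _ ≤ (ProbabilityTheory.setBernoulli (Sym2.diagSetᶜ : Set (Sym2 V)) p).real
        {s | (E.filter (· ∈ s)).card ≤ b} := by
        refine measureReal_mono ?_
        rintro _ ⟨G, hG, rfl⟩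
        simpa only [Set.mem_ofPred_eq] using hG
    _ ≤ 2 ^ b * (1 - (p : ℝ) / 2) ^ E.card := by
        rw [← hU]
        exact ProbabilityTheory.setBernoulli_real_card_filter_mem_le _ E
          (fun e he => by simpa using hE e he) p b
    _ ≤ 2 ^ b * Real.exp (-(p / 2)) ^ E.card := by
        gcongr
        linarith [Real.add_one_le_exp (-((p : ℝ) / 2))]
    _ = _ := by
        rw [← Real.exp_nat_mul]
        congr 2
        ring

end SimpleGraph

/-! ### Waiter's three-phase strategy -/

namespace SimpleGraph

open WaiterClient

variable {V : Type*} [DecidableEq V] (G : SimpleGraph V) [DecidableRel G.Adj]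

/-- The edges of `G` between `A` and `B`. -/
def edgesBetween (A B : Finset V) : Finset (Sym2 V) :=
  (G.interedges A B).image fun p => s(p.1, p.2)

variable {G} in
theorem mem_edgesBetween {A B : Finset V} {e : Sym2 V} :
    e ∈ G.edgesBetween A B ↔ ∃ a ∈ A, ∃ b ∈ B, G.Adj a b ∧ s(a, b) = e := by
  simp only [edgesBetween, Finset.mem_image, Prod.exists, mk_mem_interedges_iff]
  constructor
  · rintro ⟨a, b, ⟨ha, hb, hab⟩, rfl⟩
    exact ⟨a, ha, b, hb, hab, rfl⟩
  · rintro ⟨a, ha, b, hb, hab, rfl⟩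
    exact ⟨a, b, ⟨ha, hb, hab⟩, rfl⟩

/-- Disjointness excludes that an edge arises from two orientations. -/
theorem card_edgesBetween {A B : Finset V} (h : Disjoint A B) :
    (G.edgesBetween A B).card = (G.interedges A B).card := by
  refine Finset.card_image_of_injOn ?_
  rintro ⟨a, b⟩ hab ⟨a', b'⟩ hab' heq
  obtain ⟨ha, hb, -⟩ := (G.mk_mem_interedges_iff).1 (Finset.mem_coe.1 hab)
  obtain ⟨ha', hb', -⟩ := (G.mk_mem_interedges_iff).1 (Finset.mem_coe.1 hab')
  rcases Sym2.eq_iff.1 heq with ⟨h1, h2⟩ | ⟨h1, h2⟩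
  · exact Prod.ext h1 h2
  · dsimp only at h1
    exact absurd hb' (h1 ▸ Finset.disjoint_left.1 h ha)

theorem card_filter_le_card_of_subset_edgesBetween {H : SimpleGraph V} [DecidableRel H.Adj]
    {K : Finset (Sym2 V)} {v : V} {T : Finset V} (hK : K ⊆ G.edgesBetween {v} T)
    (hH : ∀ e ∈ K, e ∈ H.edgeSet) : K.card ≤ (T.filter (H.Adj v)).card := by
  refine (Finset.card_le_card fun e he => ?_).trans
    (Finset.card_image_le (s := T.filter (H.Adj v)) (f := fun w => s(v, w)))
  obtain ⟨a, ha, w, hw, -, rfl⟩ := mem_edgesBetween.1 (hK he)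
  rw [Finset.mem_singleton] at ha
  subst ha
  exact Finset.mem_image.2 ⟨w, Finset.mem_filter.2 ⟨hw, hH _ he⟩, rfl⟩

/-- Waiter can force a spanning `k`-vertex-connected graph if the vertices are partitioned into dense
parts and there are many edges between corresponding blocks of each part and of a fixed part. -/
theorem waiterForcesVertexConnected_of_parts {V : Type*} [Fintype V] [DecidableEq V]
    (G G' : SimpleGraph V) [DecidableRel G.Adj] [DecidableRel (G ⊔ G').Adj] {k b : ℕ}
    {f : V → Option V} {δ γ η θ ε ξ τ : ℝ}
    (hP : ∀ v, G.IsDensePart (Fintype.card V) δ γ η (colorPart f (f v)))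
    (v₀ : V) (hθ : 0 < θ) (hδ : 0 ≤ δ) (hγθ : γ + 2 * θ ≤ δ / 2)
    (hεθ : ε ≤ θ * δ / 2) (hεη : ε + 2 * θ ≤ η) (hk : (k : ℝ) ≤ θ * Fintype.card V)
    (hkV : k < Fintype.card V) (hkθ : 2 * (k + 1) * θ ≤ δ / 2)
    (hε : 0 ≤ ε) (hε4 : ε ≤ 4) (hξ : 0 < ξ) (hτε : τ + 2 * τ / ξ ≤ ε / 2)
    (hb : (b : ℝ) < ε / 4 * Fintype.card V ^ 2) (m : ℕ)
    (hm : (4 : ℝ) ^ Fintype.card V * (1 - ε / 4) ^ m < 1)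
    (hmτ : (m * (b + 1) : ℝ) ≤ τ * Fintype.card V ^ 2)
    (hstar : (k + 1) * (b + 1) + (θ + ξ) * Fintype.card V ≤ δ * Fintype.card V)
    (L : Option V → Fin k → Finset V) (hL : ∀ v s, L (f v) s ⊆ colorPart f (f v))
    (hLdisj : ∀ v s t, s ≠ t → Disjoint (L (f v) s) (L (f v) t))
    (hlink : ∀ v, f v ≠ f v₀ → ∀ s,
      b + 1 ≤ ((G ⊔ G').edgesBetween (L (f v) s) (L (f v₀) s)).card) :
    (G ⊔ G').WaiterForcesVertexConnected k b := by
  classical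
  set n := Fintype.card V with hn
  have hn0 : 0 < n := Fintype.card_pos_iff.2 ⟨v₀⟩
  set board : Finset (Sym2 V) := (G ⊔ G').edgeFinset with hboard
  have hmemboard : ∀ e, e ∈ board ↔ e ∈ (G ⊔ G').edgeSet := fun e => by simp [hboard]
  suffices h : CanReach b (fun _ client' => ∃ A ∈ (G ⊔ G').vertexConnectedFamily k, A ⊆ client')
      board ∅ by
    unfold WaiterForcesVertexConnected WaiterWins
    convert h.waiterWinsFrom using 1
    ext e
    simp [hboard]
  -- The first two phases stay inside these edges, so all edges between different parts are still
  -- free in the third.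
  set E₀ : Finset (Sym2 V) :=
    Finset.univ.filter fun e => e ∈ G.edgeSet ∧ ∀ u ∈ e, ∀ w ∈ e, f u = f w with hE₀
  have hbetween : ∀ i, ∀ A B : Finset V, A ⊆ colorPart f i → B ⊆ colorPart f i →
      G.edgesBetween A B ⊆ E₀ := by
    intro i A B hA hB e he
    obtain ⟨a, ha, c, hc, hac, rfl⟩ := mem_edgesBetween.1 he
    have ha' := mem_colorPart.1 (hA ha)
    have hc' := mem_colorPart.1 (hB hc)
    refine Finset.mem_filter.2 ⟨Finset.mem_univ _, hac, fun u hu w hw => ?_⟩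
    rcases Sym2.mem_iff.1 hu with rfl | rfl <;> rcases Sym2.mem_iff.1 hw with rfl | rfl <;>
      simp [ha', hc']
  have hE₀board : E₀ ⊆ board := by
    intro e he
    rw [hmemboard]
    exact edgeSet_mono le_sup_left (Finset.mem_filter.1 he).2.1
  have hE₀card : E₀.card ≤ n ^ 2 := by
    have : E₀ ⊆ (Finset.univ : Finset (V × V)).image fun p => s(p.1, p.2) := by
      intro e _
      induction e with | _ u w => exact Finset.mem_image.2 ⟨(u, w), Finset.mem_univ _, rfl⟩
    refine (Finset.card_le_card this).trans (Finset.card_image_le.trans ?_)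
    rw [Finset.card_univ, Fintype.card_prod, sq]
  set 𝓢 : Finset (Finset (Sym2 V)) :=
    ((Finset.univ : Finset (Finset V × Finset V)).filter fun p => Disjoint p.1 p.2 ∧
      ε * n ^ 2 ≤ (G.interedges p.1 p.2).card ∧
      ∃ i, p.1 ⊆ colorPart f i ∧ p.2 ⊆ colorPart f i).image
    fun p => G.edgesBetween p.1 p.2 with h𝓢
  have h𝓢card : (𝓢.card : ℝ) ≤ 4 ^ n := by
    have h1 : 𝓢.card ≤ 4 ^ n := by
      refine Finset.card_image_le.trans ((Finset.card_filter_le _ _).trans ?_)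
      rw [Finset.card_univ, Fintype.card_prod, Fintype.card_finset, ← mul_pow, ← hn]
      norm_num
    exact_mod_cast h1
  have hused : E₀ \ board = ∅ := Finset.sdiff_eq_empty_iff_subset.2 hE₀board
  refine (canReach_transversal (E := E₀) (𝓢 := 𝓢) hε hε4 hξ hτε hb hn0 hE₀card m ?_ ?_ ?_ ?_ ?_).bind ?_
  · intro F hF
    obtain ⟨p, hp, rfl⟩ := Finset.mem_image.1 hF
    obtain ⟨-, -, -, i, h1, h2⟩ := Finset.mem_filter.1 hp
    exact hbetween i _ _ h1 h2
  · intro F hF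
    obtain ⟨p, hp, rfl⟩ := Finset.mem_image.1 hF
    obtain ⟨-, h1, h2, -⟩ := Finset.mem_filter.1 hp
    rwa [card_edgesBetween _ h1]
  · refine lt_of_le_of_lt (mul_le_mul_of_nonneg_right h𝓢card ?_) hm
    exact pow_nonneg (by linarith) _
  · rw [hused]
    simpa using hmτ
  · intro v
    rw [hused]
    simp only [Finset.filter_empty, Finset.card_empty, Nat.cast_zero]
    positivity
  rintro free₁ client₁ hf₁ - hc₁ ⟨hfree₁, hdeg₁, hhit₁⟩
  rw [Finset.empty_union] at hc₁
  have hcore : ∀ v, ∃ D ⊆ colorPart f (f v), (D.card : ℝ) ≤ θ * n ∧ ∀ S : Finset V, S.card < k →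
      ((fromEdgeSet (client₁ : Set (Sym2 V))).induce
        (((colorPart f (f v) \ D) \ S : Finset V) : Set V)).Preconnected := by
    intro v
    refine (hP v).exists_highlyConnected_core (by exact_mod_cast Finset.card_le_univ _)
      (by exact_mod_cast hn0) hθ hδ hγθ hεθ hεη hk hkθ _ fun A B hA hB hAB hd => ?_
    obtain ⟨e, he, hec⟩ := hhit₁ (G.edgesBetween A B) (Finset.mem_image.2
      ⟨(A, B), Finset.mem_filter.2 ⟨Finset.mem_univ _, hAB, hd, f v, hA, hB⟩, rfl⟩)
    obtain ⟨a, ha, c, hc, hac, rfl⟩ := mem_edgesBetween.1 he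
    exact ⟨a, ha, c, hc, (fromEdgeSet_adj _).2 ⟨hec, hac.ne⟩⟩
  have hcore' : ∀ i, ∃ D : Finset V, ∀ v, f v = i → D ⊆ colorPart f i ∧ (D.card : ℝ) ≤ θ * n ∧
      ∀ S : Finset V, S.card < k → ((fromEdgeSet (client₁ : Set (Sym2 V))).induce
        (((colorPart f i \ D) \ S : Finset V) : Set V)).Preconnected := by
    intro i
    by_cases hi : ∃ v, f v = i
    · obtain ⟨v, rfl⟩ := hi
      obtain ⟨D, hD⟩ := hcore v
      exact ⟨D, fun _ _ => hD⟩
    · exact ⟨∅, fun v hv => absurd ⟨v, hv⟩ hi⟩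
  choose D hD using hcore'
  have hDcard : ∀ v, ((D (f v)).card : ℝ) ≤ θ * n := fun v => (hD (f v) v rfl).2.1
  have hcoreDeg : ∀ v, δ * n - θ * n ≤
      (((colorPart f (f v) \ D (f v)).filter (G.Adj v)).card : ℝ) := by
    intro v
    have h1 := (hP v).degree_ge v (by simp)
    have h2 : (colorPart f (f v)).filter (G.Adj v) ⊆
        (colorPart f (f v) \ D (f v)).filter (G.Adj v) ∪ D (f v) := by
      intro w hw
      rw [Finset.mem_filter] at hw
      by_cases hwD : w ∈ D (f v) <;> simp [hwD, hw.2, mem_colorPart.1 hw.1]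
    have h3 : (((colorPart f (f v)).filter (G.Adj v)).card : ℝ) ≤
        ((colorPart f (f v) \ D (f v)).filter (G.Adj v)).card + (D (f v)).card := by
      exact_mod_cast (Finset.card_le_card h2).trans (Finset.card_union_le _ _)
    linarith [hDcard v]
  set star : V → Finset (Sym2 V) := fun v =>
    free₁ ∩ G.edgesBetween {v} (colorPart f (f v) \ D (f v)) with hstardef
  set I : Finset V := Finset.univ.filter fun v => v ∈ D (f v) with hI
  have hstarE₀ : ∀ v, star v ⊆ E₀ := fun v => Finset.inter_subset_right.trans
    (hbetween (f v) _ _ (by simp) Finset.sdiff_subset)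
  -- Stars at different exceptional vertices are disjoint, since every edge in them has its other
  -- end in a core. At least `δ * n - θ * n` edges lead to the core, and at most `ξ * n + b + 1`
  -- edges at the vertex were offered. The overshoot `b + 1` explains the factor `k + 1` in `hstar`.
  refine (canReach_disjoint_family k I star ?_ (fun v _ => Finset.inter_subset_left) ?_).bind ?_
  · intro v hv w hw hvw
    refine Finset.disjoint_left.2 fun e he he' => ?_
    obtain ⟨a, ha, x, hx, -, rfl⟩ := mem_edgesBetween.1 (Finset.mem_inter.1 he).2
    obtain ⟨c, hc, y, hy, -, heq⟩ := mem_edgesBetween.1 (Finset.mem_inter.1 he').2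
    rw [Finset.mem_singleton] at ha hc
    subst ha hc
    rcases Sym2.eq_iff.1 heq with ⟨h1, -⟩ | ⟨h1, -⟩
    · exact hvw h1.symm
    · subst h1
      obtain ⟨hx1, hx2⟩ := Finset.mem_sdiff.1 hx
      rw [mem_colorPart] at hx1
      have := (Finset.mem_filter.1 (Finset.mem_coe.1 hw)).2
      rw [hx1] at this
      exact hx2 this
  · intro v hv
    have hdisj : Disjoint {v} (colorPart f (f v) \ D (f v)) := by
      rw [Finset.disjoint_singleton_left]
      exact fun h => (Finset.mem_sdiff.1 h).2 (Finset.mem_filter.1 hv).2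
    have h1 : G.edgesBetween {v} (colorPart f (f v) \ D (f v)) ⊆
        star v ∪ (E₀ \ free₁).filter (v ∈ ·) := by
      intro e he
      by_cases hef : e ∈ free₁
      · exact Finset.mem_union_left _ (Finset.mem_inter.2 ⟨hef, he⟩)
      · refine Finset.mem_union_right _ (Finset.mem_filter.2 ⟨Finset.mem_sdiff.2
          ⟨hbetween (f v) _ _ (by simp) Finset.sdiff_subset he, hef⟩, ?_⟩)
        obtain ⟨a, ha, x, hx, -, rfl⟩ := mem_edgesBetween.1 he
        rw [Finset.mem_singleton] at ha
        simp [ha]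
    have h2 : ((G.edgesBetween {v} (colorPart f (f v) \ D (f v))).card : ℝ) ≤
        (star v).card + ((E₀ \ free₁).filter (v ∈ ·)).card := by
      exact_mod_cast (Finset.card_le_card h1).trans (Finset.card_union_le _ _)
    rw [card_edgesBetween _ hdisj, card_interedges_eq_sum, Finset.sum_singleton] at h2
    have h3 : ((k * (b + 1) : ℕ) : ℝ) ≤ (star v).card := by
      push_cast
      linarith [hcoreDeg v, hdeg₁ v]
    exact_mod_cast h3
  rintro free₂ client₂ hf₂ hc₁₂ hc₂ ⟨hfree₂, hstar₂⟩
  set J : Finset (Option V × Fin k) := ((Finset.univ.image f).erase (f v₀)) ×ˢ Finset.univ with hJ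
  set link : Option V × Fin k → Finset (Sym2 V) := fun q =>
    (G ⊔ G').edgesBetween (L q.1 q.2) (L (f v₀) q.2) with hlinkdef
  have hJmem : ∀ q ∈ J, ∃ v, f v = q.1 ∧ f v ≠ f v₀ := by
    rintro ⟨i, s⟩ hq
    obtain ⟨h1, h2⟩ := Finset.mem_erase.1 (Finset.mem_product.1 hq).1
    obtain ⟨v, -, hv⟩ := Finset.mem_image.1 h2
    exact ⟨v, hv, hv ▸ h1⟩
  have hLf : ∀ v s x, x ∈ L (f v) s → f x = f v := fun v s x hx => mem_colorPart.1 (hL v s hx)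
  -- One edge for each part and each index `s`; disjointness of the blocks turns these `k` edges
  -- into a matching.
  refine (canReach_disjoint_family 1 J link ?_ ?_ ?_).mono ?_
  · rintro ⟨i, s⟩ hq ⟨j, t⟩ hq' hne
    obtain ⟨v, hv, hv₀⟩ := hJmem _ hq
    obtain ⟨w, hw, hw₀⟩ := hJmem _ hq'
    dsimp only at hv hw
    subst hv hw
    refine Finset.disjoint_left.2 fun e he he' => ?_
    obtain ⟨x, hx, y, hy, -, rfl⟩ := mem_edgesBetween.1 he
    obtain ⟨x', hx', y', hy', -, heq⟩ := mem_edgesBetween.1 he'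
    dsimp only at hx hy hx' hy'
    rcases Sym2.eq_iff.1 heq with ⟨h1, h2⟩ | ⟨h1, -⟩
    · subst h1 h2
      by_cases hst : s = t
      · exact hne (Prod.ext ((hLf v s _ hx).symm.trans (hLf w t _ hx')) hst)
      · exact Finset.disjoint_left.1 (hLdisj v₀ s t hst) hy hy'
    · subst h1
      exact hw₀ ((hLf w t _ hx').symm.trans (hLf v₀ s _ hy))
  · rintro ⟨i, s⟩ hq e he
    obtain ⟨v, hv, hv₀⟩ := hJmem _ hq
    dsimp only at hv
    subst hv
    obtain ⟨x, hx, y, hy, hxy, rfl⟩ := mem_edgesBetween.1 he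
    have hnot : s(x, y) ∉ E₀ := fun h => hv₀ (by
      rw [← hLf v s x hx, ← hLf v₀ s y hy]
      exact (Finset.mem_filter.1 h).2.2 x (by simp) y (by simp))
    refine hfree₂ (Finset.mem_sdiff.2 ⟨hfree₁ (Finset.mem_sdiff.2 ⟨(hmemboard _).2 hxy, hnot⟩), ?_⟩)
    intro h
    obtain ⟨w, -, hw⟩ := Finset.mem_biUnion.1 h
    exact hnot (hstarE₀ w hw)
  · rintro ⟨i, s⟩ hq
    obtain ⟨v, hv, hv₀⟩ := hJmem _ hq
    dsimp only at hv
    subst hv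
    rw [one_mul]
    exact hlink v hv₀ s
  rintro free₃ client₃ hf₃ hc₂₃ hc₃ ⟨-, hlink₃⟩
  have hc₃board : client₃ ⊆ board := by
    have h2 : client₂ ⊆ board := hc₂.trans (Finset.union_subset hc₁ hf₁)
    exact hc₃.trans (Finset.union_subset h2 (hf₂.trans hf₁))
  set H : SimpleGraph V := fromEdgeSet (client₃ : Set (Sym2 V)) with hH
  have hHedge : H.edgeSet = client₃ := by
    rw [hH, edgeSet_fromEdgeSet, sdiff_eq_left]
    refine Set.disjoint_left.2 fun e he hdiag => ?_
    exact (G ⊔ G').not_isDiag_of_mem_edgeSet ((hmemboard e).1 (hc₃board he)) (by simpa using hdiag)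
  refine ⟨client₃, ⟨H, ?_, ?_, hHedge.symm⟩, subset_rfl⟩
  · rw [← edgeSet_subset_edgeSet, hHedge]
    exact fun e he => (hmemboard e).1 (hc₃board he)
  refine isVertexConnected_of_cores (f := f) (D := D) hkV v₀ ?_ ?_ ?_ ?_
  · intro v S hS
    refine ((hD (f v) v rfl).2.2 S hS).mono ?_
    refine comap_monotone _ (fromEdgeSet_mono ?_)
    exact_mod_cast hc₁₂.trans hc₂₃
  · intro v
    have h1 := hcoreDeg v
    have h2 : (((colorPart f (f v) \ D (f v)).filter (G.Adj v)).card : ℝ) ≤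
        (colorPart f (f v) \ D (f v)).card := by exact_mod_cast Finset.card_filter_le _ _
    have h3 : (k : ℝ) ≤ (colorPart f (f v) \ D (f v)).card := by
      have : (0 : ℝ) ≤ ξ * n := by positivity
      nlinarith [mul_nonneg (Nat.cast_nonneg (α := ℝ) k) (Nat.cast_nonneg (α := ℝ) b),
        Nat.cast_nonneg (α := ℝ) b]
    exact_mod_cast h3
  · intro v hv
    obtain ⟨K, hK, hKc, hKs⟩ := hstar₂ v (Finset.mem_filter.2 ⟨Finset.mem_univ _, hv⟩)
    rw [← hKc]
    refine card_filter_le_card_of_subset_edgesBetween G (hK.trans Finset.inter_subset_right) ?_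
    intro e he
    rw [hHedge]
    exact hc₂₃ (hKs he)
  · intro v hv
    have hex : ∀ s : Fin k, ∃ x ∈ L (f v) s, ∃ y ∈ L (f v₀) s, H.Adj x y := by
      intro s
      obtain ⟨K, hK, hKc, hKs⟩ := hlink₃ (f v, s) (Finset.mem_product.2 ⟨Finset.mem_erase.2
        ⟨hv, Finset.mem_image_of_mem _ (Finset.mem_univ _)⟩, Finset.mem_univ _⟩)
      obtain ⟨e, he⟩ := Finset.card_pos.1 (hKc ▸ Nat.one_pos)
      obtain ⟨x, hx, y, hy, -, rfl⟩ := mem_edgesBetween.1 (hK he)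
      refine ⟨x, hx, y, hy, ?_⟩
      rw [← mem_edgeSet, hHedge]
      exact hKs he
    choose x hx y hy hxy using hex
    refine ⟨x, y, ?_, ?_, fun s => ⟨hLf v s _ (hx s), hLf v₀ s _ (hy s), hxy s⟩⟩
    · intro s t hst
      by_contra hne
      exact Finset.disjoint_left.1 (hLdisj v s t hne) (hx s) (hst ▸ hx t)
    · intro s t hst
      by_contra hne
      exact Finset.disjoint_left.1 (hLdisj v₀ s t hne) (hy s) (hst ▸ hy t)

end SimpleGraph

/-! ### Random edges between the blocks -/

namespace SimpleGraph

theorem exists_disjoint_subsets_card {V : Type*} [DecidableEq V] (k l : ℕ) (A : Finset V)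
    (h : k * l ≤ A.card) : ∃ P : Fin k → Finset V, (∀ s, P s ⊆ A) ∧ (∀ s, (P s).card = l) ∧
      ∀ s t, s ≠ t → Disjoint (P s) (P t) := by
  induction k generalizing A with
  | zero => exact ⟨fun _ => ∅, fun s => s.elim0, fun s => s.elim0, fun s => s.elim0⟩
  | succ k ih =>
    obtain ⟨B, hB, hBc⟩ := Finset.exists_subset_card_eq
      (show l ≤ A.card by nlinarith [Nat.zero_le (k * l)])
    obtain ⟨P, hP, hPc, hPd⟩ := ih (A \ B) (by
      rw [Finset.card_sdiff_of_subset hB, hBc]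
      apply Nat.le_sub_of_add_le
      linarith)
    have hd : ∀ s, Disjoint B (P s) := fun s =>
      Finset.disjoint_left.2 fun x hx hx' => (Finset.mem_sdiff.1 (hP s hx')).2 hx
    refine ⟨Fin.cons B P, fun s => ?_, fun s => ?_, fun s t => ?_⟩
    · refine Fin.cases ?_ (fun s => ?_) s
      · simpa using hB
      · simpa using (hP s).trans Finset.sdiff_subset
    · refine Fin.cases ?_ (fun s => ?_) s
      · simpa using hBc
      · simpa using hPc s
    · refine Fin.cases ?_ (fun s => ?_) s <;> refine Fin.cases ?_ (fun t => ?_) t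
      · simp
      · simpa using fun _ => hd t
      · simpa using (hd s).symm
      · simpa using fun hst => hPd s t hst

/-- Given blocks of linear size in the parts of a partition, with high probability a binomial random
graph has more than `b` edges between the blocks of any part and those of a fixed part. -/
theorem one_sub_le_binomialRandom_real_links {V : Type*} [Fintype V] [DecidableEq V]
    {W : Type*} [DecidableEq W] {k b : ℕ} (f : V → W) (v₀ : V) (L : W → Fin k → Finset V)
    (hL : ∀ v s, L (f v) s ⊆ colorPart f (f v)) (p : unitInterval) {β r : ℝ}
    (hβ : ∀ v s, β * Fintype.card V ^ 2 ≤ (L (f v) s).card * (L (f v₀) s).card)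
    (hr : ((Finset.univ.image f).card : ℝ) ≤ r)
    (hb : (b : ℝ) ≤ β / 4 * (p * Fintype.card V ^ 2))
    (hrk : Real.log (r * k + 1) ≤ β / 8 * (p * Fintype.card V ^ 2))
    (X : Set (SimpleGraph V))
    (hX : ∀ (G' : SimpleGraph V) [DecidableRel G'.Adj], (∀ v, f v ≠ f v₀ → ∀ s,
      b + 1 ≤ (G'.edgesBetween (L (f v) s) (L (f v₀) s)).card) → G' ∈ X) :
    1 - Real.exp (-(β / 8 * (p * Fintype.card V ^ 2))) ≤ (binomialRandom V p).real X := by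
  classical
  set n := Fintype.card V
  set E : W × Fin k → Finset (Sym2 V) := fun q =>
    (⊤ : SimpleGraph V).edgesBetween (L q.1 q.2) (L (f v₀) q.2) with hE
  set J : Finset (W × Fin k) := ((Finset.univ.image f).erase (f v₀)) ×ˢ Finset.univ with hJ
  have hcompl : Xᶜ ⊆ ⋃ q ∈ J, {G' : SimpleGraph V | ((E q).filter (· ∈ G'.edgeSet)).card ≤ b} := by
    intro G' hG'
    by_contra hno
    refine hG' (hX G' fun v hv s => ?_)
    simp only [Set.mem_iUnion, not_exists] at hno
    have h1 := hno (f v, s) (Finset.mem_product.2 ⟨Finset.mem_erase.2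
      ⟨hv, Finset.mem_image_of_mem _ (Finset.mem_univ _)⟩, Finset.mem_univ _⟩)
    have h2 : G'.edgesBetween (L (f v) s) (L (f v₀) s) =
        (E (f v, s)).filter (· ∈ G'.edgeSet) := by
      ext e
      simp only [Finset.mem_filter, hE, mem_edgesBetween, top_adj]
      constructor
      · rintro ⟨x, hx, y, hy, hxy, rfl⟩
        exact ⟨⟨x, hx, y, hy, hxy.ne, rfl⟩, hxy⟩
      · rintro ⟨⟨x, hx, y, hy, -, rfl⟩, hxy⟩
        exact ⟨x, hx, y, hy, hxy, rfl⟩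
    rw [h2]
    simpa using h1
  have hbad : ∀ q ∈ J, (binomialRandom V p).real
      {G' : SimpleGraph V | ((E q).filter (· ∈ G'.edgeSet)).card ≤ b} ≤
        Real.exp (-(β / 4 * (p * n ^ 2))) := by
    rintro ⟨i, s⟩ hq
    obtain ⟨h1, h2⟩ := Finset.mem_erase.1 (Finset.mem_product.1 hq).1
    obtain ⟨v, -, hv⟩ := Finset.mem_image.1 h2
    dsimp only at hv h1
    subst hv
    have hdisj : Disjoint (L (f v) s) (L (f v₀) s) := Finset.disjoint_left.2 fun x hx hx' =>
      h1 ((mem_colorPart.1 (hL v s hx)).symm.trans (mem_colorPart.1 (hL v₀ s hx')))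
    have hEc : (E (f v, s)).card = (L (f v) s).card * (L (f v₀) s).card := by
      rw [hE, card_edgesBetween _ hdisj, card_interedges_eq_sum,
        Finset.sum_congr rfl (g := fun _ => (L (f v₀) s).card), Finset.sum_const, smul_eq_mul]
      intro x hx
      rw [Finset.filter_true_of_mem]
      intro y hy
      rw [top_adj]
      rintro rfl
      exact Finset.disjoint_left.1 hdisj hx hy
    refine (Eq.trans_le (by congr!)
      (binomialRandom_real_card_filter_le (E (f v, s)) (fun e he => ?_) p b)).trans ?_
    · obtain ⟨x, -, y, -, hxy, rfl⟩ := mem_edgesBetween.1 he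
      simpa using hxy
    · have h3 : (2 : ℝ) ^ b ≤ Real.exp b := by
        rw [← Real.exp_one_pow]
        gcongr
        linarith [Real.add_one_le_exp (1 : ℝ)]
      calc _ ≤ Real.exp b * Real.exp (-(p * (E (f v, s)).card / 2)) := by gcongr
        _ = Real.exp (b + -(p * (E (f v, s)).card / 2)) := (Real.exp_add _ _).symm
        _ ≤ _ := by
          rw [Real.exp_le_exp, hEc]
          push_cast
          nlinarith [mul_le_mul_of_nonneg_left (hβ v s) p.2.1]
  have hJc : (J.card : ℝ) ≤ r * k := by
    have : J.card ≤ (Finset.univ.image f).card * k := by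
      rw [hJ, Finset.card_product, Finset.card_univ, Fintype.card_fin]
      exact Nat.mul_le_mul_right _ (Finset.card_le_card (Finset.erase_subset _ _))
    have h' : (J.card : ℝ) ≤ (Finset.univ.image f).card * k := by exact_mod_cast this
    exact h'.trans (by gcongr)
  have hr0 : 0 ≤ r := (Nat.cast_nonneg _).trans hr
  have hfail : (binomialRandom V p).real Xᶜ ≤ Real.exp (-(β / 8 * (p * n ^ 2))) := by
    calc _ ≤ (binomialRandom V p).real (⋃ q ∈ J,
          {G' : SimpleGraph V | ((E q).filter (· ∈ G'.edgeSet)).card ≤ b}) :=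
          MeasureTheory.measureReal_mono hcompl (MeasureTheory.measure_ne_top _ _)
      _ ≤ ∑ q ∈ J, (binomialRandom V p).real
          {G' : SimpleGraph V | ((E q).filter (· ∈ G'.edgeSet)).card ≤ b} :=
          MeasureTheory.measureReal_biUnion_finset_le _ _
      _ ≤ ∑ q ∈ J, Real.exp (-(β / 4 * (p * n ^ 2))) := Finset.sum_le_sum hbad
      _ = J.card * Real.exp (-(β / 4 * (p * n ^ 2))) := by rw [Finset.sum_const, nsmul_eq_mul]
      -- Half of the exponent pays for the union bound over at most `r * k` pairs of blocks.
      _ ≤ Real.exp (β / 8 * (p * n ^ 2)) * Real.exp (-(β / 4 * (p * n ^ 2))) := by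
          gcongr
          have h1 := (Real.log_le_iff_le_exp (by positivity)).1 hrk
          linarith
      _ = _ := by
          rw [← Real.exp_add]
          congr 1
          ring
  -- Subadditivity alone gives this direction, so measurability of `X` plays no role.
  have hone : (1 : ℝ) ≤ (binomialRandom V p).real X + (binomialRandom V p).real Xᶜ := by
    have h := MeasureTheory.measureReal_union_le (μ := binomialRandom V p) X Xᶜ
    rwa [Set.union_compl_self, MeasureTheory.probReal_univ] at h
  linarith

end SimpleGraph

/-! ### Choice of constants and conclusion -/

theorem four_mul_exp_neg_two_lt_one : 4 * Real.exp (-2) < 1 := by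
  rw [Real.exp_neg, ← div_eq_mul_inv, div_lt_one (Real.exp_pos _)]
  have h1 : Real.exp 2 = Real.exp 1 * Real.exp 1 := by rw [← Real.exp_add]; norm_num
  have h2 := Real.exp_one_gt_d9
  nlinarith

/-- The numerical conditions relating the constants of the strategy. -/
theorem exists_strategy_constants {α : ℝ} (hα : 0 < α) (hα1 : α ≤ 1) (k : ℕ) :
    ∃ θ ε ξ τ : ℝ, 0 < θ ∧ 0 < ε ∧ 0 < ξ ∧ 0 < τ ∧ τ ≤ 1 ∧ ε ≤ 1 ∧
      α ^ 2 / 8 + 2 * θ ≤ α ^ 2 / 2 / 2 ∧ ε ≤ θ * (α ^ 2 / 2) / 2 ∧ ε + 2 * θ ≤ α ^ 5 / 256 ∧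
      2 * (k + 1) * θ ≤ α ^ 2 / 2 / 2 ∧ τ + 2 * τ / ξ ≤ ε / 2 ∧ θ + ξ ≤ α ^ 2 / 4 := by
  have hk : (0 : ℝ) ≤ k := Nat.cast_nonneg k
  have h2 : α ^ 2 ≤ 1 := pow_le_one₀ hα.le hα1
  have h5 : α ^ 5 ≤ α ^ 2 := pow_le_pow_of_le_one hα.le hα1 (by norm_num)
  have hp2 : 0 < α ^ 2 := by positivity
  have hp5 : 0 < α ^ 5 := by positivity
  -- The choice is sequential: `θ` is small against the cut density and `1 / (k + 1)`, `ε` is the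
  -- density guaranteed by minimum degree for sets of size `θ * n`, and `τ` makes `2 * τ / ξ` equal
  -- to `ε / 4`.
  set θ : ℝ := α ^ 5 / 256 / (8 * (k + 1)) with hθ
  have hθ0 : 0 < θ := by positivity
  have hθk : θ * (8 * (k + 1)) = α ^ 5 / 256 := div_mul_cancel₀ _ (by positivity)
  have hkθ : 0 ≤ k * θ := by positivity
  set ε : ℝ := θ * (α ^ 2 / 2) / 2 with hε
  have hε0 : 0 < ε := by positivity
  have hεθ : ε ≤ θ := by rw [hε]; nlinarith
  set ξ : ℝ := α ^ 2 / 8 with hξ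
  have hξ0 : 0 < ξ := by positivity
  set τ : ℝ := ε * ξ / 8 with hτ
  have hτ0 : 0 < τ := by positivity
  have hξ1 : ξ ≤ 1 := by linarith
  have hτε : τ ≤ ε / 8 := by rw [hτ]; nlinarith
  have hτξ : 2 * τ / ξ = ε / 4 := by rw [hτ]; field_simp; ring
  refine ⟨θ, ε, ξ, τ, hθ0, hε0, hξ0, hτ0, ?_, ?_, ?_, le_rfl, ?_, ?_, ?_, ?_⟩ <;> nlinarith

open SimpleGraph in
/-- The partition and the blocks used by the strategy, together with the fact that many edges between
blocks suffice for Waiter. -/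
theorem exists_parts_of_minDegree {α : ℝ} (hα : 0 < α) (hα1 : α ≤ 1) (k : ℕ) :
    ∃ c β r : ℝ, 0 < c ∧ 0 < β ∧ 0 ≤ r ∧ ∃ n₀ : ℕ, ∀ n : ℕ, n₀ ≤ n →
      ∀ (G : SimpleGraph (Fin n)) [DecidableRel G.Adj], α * (n : ℝ) ≤ (G.minDegree : ℝ) →
      ∃ (f : Fin n → Option (Fin n)) (v₀ : Fin n) (L : Option (Fin n) → Fin k → Finset (Fin n)),
        (∀ v s, L (f v) s ⊆ colorPart f (f v)) ∧
        (∀ v s, β * (n : ℝ) ^ 2 ≤ (L (f v) s).card * (L (f v₀) s).card) ∧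
        ((Finset.univ.image f).card : ℝ) ≤ r ∧
        ∀ b : ℕ, 1 ≤ b → (b : ℝ) ≤ c * (n : ℝ) →
          ∀ (G' : SimpleGraph (Fin n)) [DecidableRel G'.Adj], (∀ v, f v ≠ f v₀ → ∀ s,
            b + 1 ≤ (G'.edgesBetween (L (f v) s) (L (f v₀) s)).card) →
          (G ⊔ G').WaiterForcesVertexConnected k b := by
  obtain ⟨θ, ε, ξ, τ, hθ0, hε0, hξ0, hτ0, hτ1, hε1, hγθ, hεθ, hεη, hkθ, hτε, hθξ⟩ :=
    exists_strategy_constants hα hα1 k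
  set δ : ℝ := α ^ 2 / 2 with hδ
  have hδ0 : 0 < δ := by positivity
  have hk1 : (0 : ℝ) < k + 1 := by positivity
  -- The first bound on `c` limits the edges offered in about `8 * n / ε` rounds, the second keeps
  -- the stars large enough. The value of `β` comes from blocks of size at least `δ * n / (2 * (k +
  -- 1))`, and `1 / δ` from parts of size at least `δ * n`.
  refine ⟨min (τ * ε / 18) (δ / (8 * (k + 1))), (δ / (2 * (k + 1))) ^ 2, 1 / δ, by positivity,
    by positivity, by positivity,
    ⌈k / θ⌉₊ + ⌈4 / α⌉₊ + ⌈2 * (k + 1) / δ⌉₊ + k + 1, fun n hn G _ hdeg => ?_⟩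
  have hceil : ∀ {x : ℝ}, ⌈x⌉₊ ≤ n → x ≤ n := fun h => (Nat.le_ceil _).trans (by exact_mod_cast h)
  have hn1 : (k : ℝ) / θ ≤ n := hceil (by omega)
  have hn2 : 4 / α ≤ n := hceil (by omega)
  have hn3 : 2 * (k + 1) / δ ≤ n := hceil (by omega)
  have hkn : k < n := by omega
  have hn0 : 0 < n := by omega
  have hnR : (1 : ℝ) ≤ n := by exact_mod_cast hn0
  rw [div_le_iff₀ hθ0, mul_comm] at hn1
  rw [div_le_iff₀ hα, mul_comm] at hn2
  rw [div_le_iff₀ hδ0, mul_comm] at hn3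
  obtain ⟨f, hf1, hf2⟩ := G.exists_partition_without_sparse_cuts hα hα1
    (fun v => by
      rw [Fintype.card_fin]
      exact hdeg.trans (by exact_mod_cast G.minDegree_le_degree v))
    (by rwa [Fintype.card_fin])
  have hpart : ∀ v, G.IsDensePart (Fintype.card (Fin n)) δ (α ^ 2 / 8) (α ^ 5 / 256)
      (colorPart f (f v)) := fun v => ⟨fun w hw => by
        have := hf1 w
        rwa [mem_colorPart.1 hw] at this, hf2 v⟩
  rw [Fintype.card_fin] at hpart hf1
  have hsize : ∀ v, δ * n ≤ (colorPart f (f v)).card := fun v =>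
    (hf1 v).trans (by exact_mod_cast Finset.card_filter_le _ _)
  set l : ℕ := ⌊δ * n / (k + 1)⌋₊ with hl
  have hlle : (l : ℝ) ≤ δ * n / (k + 1) := Nat.floor_le (by positivity)
  have hlge : δ / (2 * (k + 1)) * n ≤ l := by
    have h1 := Nat.lt_floor_add_one (δ * n / (k + 1))
    have h2 : δ * n / (k + 1) = 2 * (δ / (2 * (k + 1)) * n) := by field_simp
    have h3 : 1 ≤ δ / (2 * (k + 1)) * n := by
      rw [div_mul_eq_mul_div, le_div_iff₀ (by positivity)]
      linarith
    linarith
  have hblocks : ∀ i, ∃ P : Fin k → Finset (Fin n), ∀ v, f v = i → (∀ s, P s ⊆ colorPart f i) ∧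
      (∀ s, (P s).card = l) ∧ ∀ s t, s ≠ t → Disjoint (P s) (P t) := by
    intro i
    by_cases hi : ∃ v, f v = i
    · obtain ⟨v, rfl⟩ := hi
      obtain ⟨P, hP⟩ := exists_disjoint_subsets_card k l (colorPart f (f v)) (by
        have h1 : ((k * l : ℕ) : ℝ) ≤ (colorPart f (f v)).card := by
          refine le_trans ?_ (hsize v)
          push_cast
          rw [le_div_iff₀ hk1] at hlle
          linarith [Nat.cast_nonneg (α := ℝ) l]
        exact_mod_cast h1)
      exact ⟨P, fun _ _ => hP⟩
    · exact ⟨fun _ => ∅, fun v hv => absurd ⟨v, hv⟩ hi⟩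
  choose L hL using hblocks
  refine ⟨f, ⟨0, hn0⟩, L, fun v => (hL _ v rfl).1, fun v s => ?_, ?_, fun b hb1 hbc G' _ hG' => ?_⟩
  · rw [(hL _ v rfl).2.1, (hL _ _ rfl).2.1, ← mul_pow, ← sq]
    gcongr
  · have h := card_image_mul_le f hsize
    rw [Fintype.card_fin, ← mul_assoc] at h
    have h' := le_of_mul_le_mul_right (by linarith :
      (Finset.univ.image f).card * δ * (n : ℝ) ≤ 1 * n) (by linarith)
    rwa [le_div_iff₀ hδ0]
  have hbR : (1 : ℝ) ≤ b := by exact_mod_cast hb1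
  have hb18 : (b : ℝ) ≤ τ * ε / 18 * n := hbc.trans (by gcongr; exact min_le_left _ _)
  have hb8 : (b : ℝ) ≤ δ / (8 * (k + 1)) * n := hbc.trans (by gcongr; exact min_le_right _ _)
  have hεn : 0 < ε * n := by positivity
  have hm := Nat.le_ceil (8 * n / ε)
  have hm' := Nat.ceil_lt_add_one (a := 8 * n / ε) (by positivity)
  set m := ⌈8 * n / ε⌉₊
  have hmn : (m : ℝ) * ε ≤ 9 * n := by
    have : (8 * n / ε + 1) * ε = 8 * n + ε := by field_simp
    nlinarith
  rw [div_le_iff₀ hε0] at hm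
  refine waiterForcesVertexConnected_of_parts (f := f) (γ := α ^ 2 / 8) (η := α ^ 5 / 256)
    (ξ := ξ) (τ := τ) (θ := θ) (ε := ε) (δ := δ) G G' ?_ ⟨0, hn0⟩ hθ0 hδ0.le hγθ hεθ hεη
    ?_ ?_ hkθ hε0.le (by linarith) hξ0 hτε ?_ m ?_ ?_ ?_ L (fun v => (hL _ v rfl).1)
    (fun v => (hL _ v rfl).2.2) fun v hv s => (hG' v hv s).trans (Finset.card_le_card ?_)
  · rwa [Fintype.card_fin]
  · rwa [Fintype.card_fin]
  · rwa [Fintype.card_fin]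
  · rw [Fintype.card_fin]
    calc (b : ℝ) ≤ τ * ε / 18 * n := hb18
      _ = τ * (ε * n) / 18 := by ring
      _ ≤ 1 * (ε * n) / 18 := by gcongr
      _ < ε / 4 * (n * 1) := by linarith
      _ ≤ ε / 4 * (n * n) := by gcongr
      _ = ε / 4 * n ^ 2 := by ring
  · rw [Fintype.card_fin]
    have h1 : (1 - ε / 4) ^ m ≤ Real.exp (-2) ^ n := by
      calc (1 - ε / 4) ^ m ≤ Real.exp (-(ε / 4)) ^ m := by
            gcongr
            · linarith
            · linarith [Real.add_one_le_exp (-(ε / 4))]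
        _ ≤ Real.exp (-2) ^ n := by
            rw [← Real.exp_nat_mul, ← Real.exp_nat_mul, Real.exp_le_exp]
            linarith
    -- The choice of `m` gives a decay of `exp (-2)` per vertex, which beats the factor 4 per vertex
    -- from counting pairs of vertex sets.
    calc (4 : ℝ) ^ n * (1 - ε / 4) ^ m ≤ 4 ^ n * Real.exp (-2) ^ n := by gcongr
      _ = (4 * Real.exp (-2)) ^ n := (mul_pow _ _ _).symm
      _ < 1 := pow_lt_one₀ (by positivity) four_mul_exp_neg_two_lt_one hn0.ne'
  · rw [Fintype.card_fin]
    calc (m : ℝ) * (b + 1) ≤ m * (2 * (τ * ε / 18 * n)) := by gcongr; linarith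
      _ = τ * n / 9 * (m * ε) := by ring
      _ ≤ τ * n / 9 * (9 * n) := by gcongr
      _ = τ * n ^ 2 := by ring
  · rw [Fintype.card_fin]
    have h1 : ((k : ℝ) + 1) * (b + 1) ≤ δ / 4 * n := by
      calc ((k : ℝ) + 1) * (b + 1) ≤ (k + 1) * (2 * (δ / (8 * (k + 1)) * n)) := by
            gcongr; linarith
        _ = δ / 4 * n := by field_simp; ring
    have h2 : (θ + ξ) * n ≤ δ / 2 * n := by gcongr; linarith
    have h3 : 0 < δ * n := by positivity
    linarith
  · intro e he
    obtain ⟨x, hx, y, hy, hxy, rfl⟩ := mem_edgesBetween.1 he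
    exact mem_edgesBetween.2 ⟨x, hx, y, hy, Or.inr hxy, rfl⟩

theorem theorem1p7 (α : ℝ) (hα : 0 < α) (k : ℕ) :
    ∃ C c : ℝ, 0 < C ∧ 0 < c ∧ ∃ n₀ : ℕ, ∀ n : ℕ, n₀ ≤ n →
      ∀ (G : SimpleGraph (Fin n)) [DecidableRel G.Adj], α * (n : ℝ) ≤ (G.minDegree : ℝ) →
      ∀ b : ℕ, 1 ≤ b → (b : ℝ) ≤ c * (n : ℝ) →
      ∀ p : unitInterval, C * (b : ℝ) / (n : ℝ) ^ 2 ≤ (p : ℝ) →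
        1 - Real.exp (-(c * (p : ℝ) * (n : ℝ) ^ 2)) ≤
          (SimpleGraph.binomialRandom (Fin n) p).real
            {G' : SimpleGraph (Fin n) | (G ⊔ G').WaiterForcesVertexConnected k b} := by
  -- For `α > 1` no graph qualifies, as the minimum degree is less than `n`.
  rcases lt_or_ge 1 α with hα1 | hα1
  · refine ⟨1, 1, one_pos, one_pos, 1, fun n hn G _ hdeg => ?_⟩
    have h1 : G.minDegree < n :=
      (G.minDegree_le_degree ⟨0, hn⟩).trans_lt
        ((G.degree_lt_card_verts _).trans_eq (Fintype.card_fin n))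
    have h2 : (G.minDegree : ℝ) < n := by exact_mod_cast h1
    nlinarith
  obtain ⟨c, β, r, hc, hβ, hr, n₀, H⟩ := exists_parts_of_minDegree hα hα1 k
  have hlog : 0 ≤ Real.log (r * k + 1) := Real.log_nonneg (by
    have : 0 ≤ r * k := by positivity
    linarith)
  -- The first summand of `C` makes the expected number of linking edges exceed `b` sufficiently;
  -- the second, using `1 ≤ b`, covers the union bound.
  refine ⟨4 / β + 8 / β * Real.log (r * k + 1), min c (β / 8), by positivity, by positivity,
    n₀ + 1, fun n hn G _ hdeg b hb hbc p hp => ?_⟩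
  obtain ⟨f, v₀, L, hL, hLβ, hfr, hwin⟩ := H n (by omega) G hdeg
  have hn0 : (0 : ℝ) < n := by exact_mod_cast (by omega : 0 < n)
  have hbR : (1 : ℝ) ≤ b := by exact_mod_cast hb
  rw [div_le_iff₀ (by positivity)] at hp
  have hp4 : (b : ℝ) ≤ β / 4 * (p * n ^ 2) := by
    have h1 : (b : ℝ) = β / 4 * (4 / β * b) := by field_simp
    rw [h1]
    refine mul_le_mul_of_nonneg_left (le_trans ?_ hp) (by positivity)
    gcongr
    have : 0 ≤ 8 / β * Real.log (r * k + 1) := by positivity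
    linarith
  have hp8 : Real.log (r * k + 1) ≤ β / 8 * (p * n ^ 2) := by
    have h1 : Real.log (r * k + 1) = β / 8 * (8 / β * Real.log (r * k + 1) * 1) := by field_simp
    rw [h1]
    refine mul_le_mul_of_nonneg_left (le_trans ?_ hp) (by positivity)
    gcongr
    have : 0 ≤ 4 / β := by positivity
    linarith
  refine le_trans ?_ (SimpleGraph.one_sub_le_binomialRandom_real_links (β := β) (r := r) (b := b)
    f v₀ L hL p (by simpa using hLβ) hfr (by simpa using hp4) (by simpa using hp8) _
    fun G' _ hG' => hwin b hb (hbc.trans (by gcongr; exact min_le_left _ _)) G' hG')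
  rw [Fintype.card_fin, mul_assoc]
  gcongr
  · exact mul_nonneg p.2.1 (sq_nonneg _)
  · exact min_le_right _ _
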